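/- **Model.** Let $d\ge 0$, $W>0$, $s_0\ge 1$, $\alpha\in(0,1)$, $T\ge 2$, and $\Omega=\{\theta\in\mathbb R^d:\|\theta\|_0\le s_0,\ \|\theta\|_1\le W\}$. In round $t=1,\dots,T$ a product with context $x_t\in\mathbb R^d$, $\|x_t\|_\infty\le 1$, arrives, a price $p_t$ is posted, and a sale $y_t=+1$ is observed if $V_t=\langle\theta_0,x_t\rangle+\eta_t\ge p_t$, and $y_t=-1$ otherwise; here $\theta_0\in\Omega$ is the true parameter. Let $\mathcal H_{t-1}=\sigma(x_1,p_1,y_1,\dots,x_{t-1},p_{t-1},y_{t-1},x_t,p_t)$. The noise is integrable with $\mathbb E[\eta_t\mid\mathcal H_{t-1}]=0$, and $F_t$ denotes the (random) conditional distribution function of $\eta_t$ given $\mathcal H_{t-1}$, $f_t=F_t'$. Almost surely, for every $t\le T$: $F_t$ and $1-F_t$ are log-concave; on $[-3W,3W]$ the function $F_t$ is twice differentiable with values in $(0,1)$, and for constants $u_W$ and $l_W>0$ $$\sup_{|z|\le 3W}\max\{(\log F_t)'(z),-(\log(1-F_t))'(z)\}\le u_W,\qquad \inf_{|z|\le 3W}\min\{-(\log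 F_t)''(z),-(\log(1-F_t))''(z)\}\ge l_W;$$ the pricing function $g_t(v)=v+\varphi_t^{-1}(-v)$, $\varphi_t(z)=z-(1-F_t(z))/f_t(z)$, is well defined and at most $2W$ for $|v|\le W$. **Policy OORMLP.** The initial price $p_1$ is arbitrary with $|p_1|\le 2W$. For $1\le t<T$, with $\widehat\Sigma_{[t]}=t^{-1}\sum_{s\le t}x_sx_s^\top$ and $\lambda_t(\alpha)=4u_W\sqrt{2t^{-1}\|\mathrm{diag}(\widehat\Sigma_{[t]})\|_\infty\ln(2d/\alpha)}$, let $\widehat\theta_t$ be a minimizer, measurable with respect to $\sigma(x_s,p_s,y_s:s\le t)$, of $\mathcal L_t(\theta)+\lambda_t(\alpha)\|\theta\|_1$ over $\|\theta\|_1\le W$, where $\mathcal L_t(\theta)$ is the average over $s\le t$ of $-\log(1-F_s(p_s-\langle\theta,x_s\rangle))$ if $y_s=+1$ and of $-\log F_s(p_s-\langle\theta,x_s\rangle)$ if $y_s=-1$; then $p_{t+1}=g_{t+1}(\langle\widehat\theta_t,x_{t+1}\rangle)$. The oracle price is $p_t^*=g_t(\langle\theta_0,x_t\rangle)$, and $r_t(p)=p\,\mathbf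 1\{V_t\ge p\}$. **Restricted eigenvalue process condition.** Almost surely, for all $t\le T$ with $t\ge n_0$, $$\min_{J\subseteq[d],|J|\le s_0}\ \min_{v\ne 0,\ \|v_{J^c}\|_1\le 3\|v_J\|_1}\frac{v^\top\widehat\Sigma_{[t]}v}{\|v_J\|_2^2}\ \ge\ \phi_t^2,\qquad \phi_t\ge\phi_{\min}>0 .$$ **Theorem.** There are a constant $C_1$ that depends only on $(d,W,u_W)$ and a constant $C_2$ that depends only on $(d,W,u_W,s_0,n_0,l_W,\alpha,\phi_{\min})$ such that, in every such model and for every $T\ge 2$, all the revenue losses and squared errors below are integrable and: 1. with probability at least $1-\alpha$, $$\sum_{t=1}^T\mathbb E[r_t(p_t^*)-r_t(p_t)\mid\mathcal H_{t-1}]\ \le\ \mathbb E[r_1(p_1^*)-r_1(p_1)\mid\mathcal H_0]+C_1\sum_{t=2}^T\mathbb E\big[\|\widehat\theta_{t-1}-\theta_0\|_2^2\mid\mathcal H_{t-1}\big]\ \le\ C_2\log T;$$ 2. $\displaystyle \mathbb E\Big[\sum_{t=1}^T(r_t(p_t^*)-r_t(p_t))\Big]\le\mathbb E[r_1(p_1^*)-r_1(p_1)]+C_1\sum_{t=2}^T\mathbb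 E\|\widehat\theta_{t-1}-\theta_0\|_2^2;$ 3. the regret $\displaystyle \mathbf{Regret}_\pi(T)=\sup_{\theta_0\in\Theta}\mathbb E_{\theta_0}\Big[\sum_{t=1}^T(r_t(p_t^*)-r_t(p_t))\Big]$ is at most $C_2\log T$ for every set $\Theta\subseteq\Omega$ of true parameters and every family of such models indexed by $\Theta$, in particular for $\Theta=\Omega$. -/

import Mathlib

open MeasureTheory ProbabilityTheory

noncomputable section

namespace OORMLP

/-! ### Vectors, parameter space, restricted eigenvalues -/

/-- The `ℓ₁` norm on `ℝᵈ`. -/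
def l1 {d : ℕ} (v : Fin d → ℝ) : ℝ := ∑ i, |v i|

/-- The squared Euclidean norm on `ℝᵈ`. -/
def sqL2 {d : ℕ} (v : Fin d → ℝ) : ℝ := ∑ i, v i ^ 2

/-- The sparse parameter space: at most `s₀` nonzero coordinates and `ℓ₁` norm at most `W`. -/
def paramSpace (d s₀ : ℕ) (W : ℝ) : Set (Fin d → ℝ) :=
  {θ | (Function.support θ).ncard ≤ s₀ ∧ l1 θ ≤ W}

/-- The restricted eigenvalue of `A` at sparsity level `s₀` is at least `c`. A nonzero vector `v`
of the cone has `v_J ≠ 0`, so the quotient is never by zero. -/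
def RestrictedEigenvalueGE {d : ℕ} (s₀ : ℕ) (A : Matrix (Fin d) (Fin d) ℝ) (c : ℝ) : Prop :=
  ∀ J : Finset (Fin d), J.card ≤ s₀ → ∀ v : Fin d → ℝ, v ≠ 0 →
    ∑ i ∈ Jᶜ, |v i| ≤ 3 * ∑ i ∈ J, |v i| →
      c ≤ (v ⬝ᵥ A.mulVec v) / ∑ i ∈ J, v i ^ 2

/-! ### The law of the noise and the pricing function -/

/-- Steepness `sup_{|z| ≤ 3W} max {(log F)'(z), -(log (1 - F))'(z)}`. -/
def steepness (ν : Measure ℝ) (W : ℝ) : EReal :=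
  ⨆ z ∈ Set.Icc (-(3 * W)) (3 * W),
    ((max (deriv (fun a => Real.log (cdf ν a)) z)
      (-deriv (fun a => Real.log (1 - cdf ν a)) z) : ℝ) : EReal)

/-- Flatness `inf_{|z| ≤ 3W} min {-(log F)''(z), -(log (1 - F))''(z)}`. -/
def flatness (ν : Measure ℝ) (W : ℝ) : EReal :=
  ⨅ z ∈ Set.Icc (-(3 * W)) (3 * W),
    ((min (-deriv (deriv (fun a => Real.log (cdf ν a))) z)
      (-deriv (deriv (fun a => Real.log (1 - cdf ν a))) z) : ℝ) : EReal)

/-- The virtual valuation `φ(z) = z - (1 - F(z)) / f(z)`, with `f = F'` the density. -/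
def virtualValue (ν : Measure ℝ) (z : ℝ) : ℝ := z - (1 - cdf ν z) / deriv (cdf ν) z

/-- The points inside the support, where `0 < F < 1` and the density exists and is positive. -/
def densityRegion (ν : Measure ℝ) : Set ℝ :=
  {z | 0 < cdf ν z ∧ cdf ν z < 1 ∧ 0 < deriv (cdf ν) z}

/-- The pricing function `g(v) = v + φ⁻¹(-v)`. -/
def priceFn (ν : Measure ℝ) (v : ℝ) : ℝ :=
  v + Function.invFunOn (virtualValue ν) (densityRegion ν) (-v)

/-- Log-concave noise law: `F` and `1 - F` are log-concave; on `[-3W, 3W]` the function `F` takes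
values in `(0, 1)`, is twice differentiable, has steepness at most `uW` and flatness at least `lW`;
and the optimal price `g(v)` exists and is at most `2W` for the mean valuations `|v| ≤ W`. -/
structure IsNoiseLaw (W uW lW : ℝ) (ν : Measure ℝ) : Prop where
  logConcave_cdf : ConcaveOn ℝ {z | 0 < cdf ν z} (fun z => Real.log (cdf ν z))
  logConcave_tail : ConcaveOn ℝ {z | cdf ν z < 1} (fun z => Real.log (1 - cdf ν z))
  cdf_pos : ∀ z ∈ Set.Icc (-(3 * W)) (3 * W), 0 < cdf ν z
  cdf_lt_one : ∀ z ∈ Set.Icc (-(3 * W)) (3 * W), cdf ν z < 1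
  differentiable : ∀ z ∈ Set.Icc (-(3 * W)) (3 * W), DifferentiableAt ℝ (cdf ν) z
  differentiable_deriv : ∀ z ∈ Set.Icc (-(3 * W)) (3 * W), DifferentiableAt ℝ (deriv (cdf ν)) z
  steepness_le : steepness ν W ≤ (uW : EReal)
  le_flatness : (lW : EReal) ≤ flatness ν W
  price_exists : ∀ v ∈ Set.Icc (-W) W, -v ∈ virtualValue ν '' densityRegion ν
  price_le : ∀ v ∈ Set.Icc (-W) W, priceFn ν v ≤ 2 * W

/-! ### A run of a pricing policy -/

/-- The processes in a run of a pricing policy; rounds are numbered `1, 2, …`. -/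
structure Run (d : ℕ) (Ω : Type*) where
  /-- product context `x_t` -/
  x : ℕ → Ω → Fin d → ℝ
  /-- market noise `η_t` -/
  η : ℕ → Ω → ℝ
  /-- conditional law of `η_t` given the history before the `t`-th sale status is observed -/
  law : ℕ → Ω → Measure ℝ
  /-- posted price `p_t` -/
  p : ℕ → Ω → ℝ
  /-- estimator `θ̂_t` computed from the first `t` transaction records -/
  est : ℕ → Ω → Fin d → ℝ

namespace Run

variable {d : ℕ} {Ω : Type*} (R : Run d Ω) (θ₀ : Fin d → ℝ)

/-- Willingness to pay `V_t = ⟨θ₀, x_t⟩ + η_t`. -/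
def valuation (t : ℕ) (ω : Ω) : ℝ := θ₀ ⬝ᵥ R.x t ω + R.η t ω

/-- Sale status `y_t`: `+1` if `V_t ≥ p_t`, otherwise `-1`. -/
def sale (t : ℕ) (ω : Ω) : ℤ := if R.p t ω ≤ R.valuation θ₀ t ω then 1 else -1

/-- The σ-algebra of the first `t` transaction records `(x_s, p_s, y_s)`, `1 ≤ s ≤ t`. -/
@[reducible] def records (t : ℕ) : MeasurableSpace Ω :=
  ⨆ s ∈ Finset.Icc 1 t, (MeasurableSpace.comap (R.x s) inferInstance ⊔
    MeasurableSpace.comap (R.p s) inferInstance ⊔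
    MeasurableSpace.comap (R.sale θ₀ s) inferInstance)

/-- `ℋ_{t-1}`: all that is known in round `t ≥ 1` before `y_t` is observed, that is, the first
`t - 1` records together with `x_t` and `p_t`. -/
@[reducible] def hist (t : ℕ) : MeasurableSpace Ω :=
  R.records θ₀ (t - 1) ⊔ MeasurableSpace.comap (R.x t) inferInstance ⊔
    MeasurableSpace.comap (R.p t) inferInstance

/-- Empirical covariance matrix `t⁻¹ ∑_{s ≤ t} x_s x_sᵀ`. -/
def empCov (t : ℕ) (ω : Ω) : Matrix (Fin d) (Fin d) ℝ :=
  (t : ℝ)⁻¹ • ∑ s ∈ Finset.Icc 1 t, Matrix.vecMulVec (R.x s ω) (R.x s ω)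

/-- The probability that the model with parameter `θ` gives to the observed sale status `y_t`. -/
def saleProb (θ : Fin d → ℝ) (t : ℕ) (ω : Ω) : ℝ :=
  if R.sale θ₀ t ω = 1 then 1 - cdf (R.law t ω) (R.p t ω - θ ⬝ᵥ R.x t ω)
  else cdf (R.law t ω) (R.p t ω - θ ⬝ᵥ R.x t ω)

/-- Self-information loss `ℒ_t(θ)`: the mean negative log-likelihood of the first `t` records. -/
def loss (t : ℕ) (ω : Ω) (θ : Fin d → ℝ) : ℝ :=
  (t : ℝ)⁻¹ * ∑ s ∈ Finset.Icc 1 t, Real.log (1 / R.saleProb θ₀ θ s ω)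

/-- Online regularization `λ_t(α) = 4 u_W √(2 t⁻¹ ‖diag Σ̂_t‖_∞ ln (2d / α))`. -/
def reg (uW α : ℝ) (t : ℕ) (ω : Ω) : ℝ :=
  4 * uW * Real.sqrt (2 * (t : ℝ)⁻¹ * (⨆ i, |R.empCov t ω i i|) * Real.log (2 * d / α))

/-- `θ` minimizes `ℒ_t(θ) + λ_t ‖θ‖₁` over the `ℓ₁` ball of radius `W`. -/
def IsLasso (W uW α : ℝ) (t : ℕ) (ω : Ω) (θ : Fin d → ℝ) : Prop :=
  l1 θ ≤ W ∧ IsMinOn (fun θ' => R.loss θ₀ t ω θ' + R.reg uW α t ω * l1 θ') {θ' | l1 θ' ≤ W} θ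

/-- Oracle price `p_t* = g(⟨θ₀, x_t⟩)`. -/
def oraclePrice (t : ℕ) (ω : Ω) : ℝ := priceFn (R.law t ω) (θ₀ ⬝ᵥ R.x t ω)

/-- Revenue `r_t(q) = q · 1{V_t ≥ q}` of round `t` at price `q`. -/
def revenue (t : ℕ) (ω : Ω) (q : ℝ) : ℝ := if q ≤ R.valuation θ₀ t ω then q else 0

/-- Revenue loss `r_t(p_t*) - r_t(p_t)` of round `t`. -/
def revenueLoss (t : ℕ) (ω : Ω) : ℝ :=
  R.revenue θ₀ t ω (R.oraclePrice θ₀ t ω) - R.revenue θ₀ t ω (R.p t ω)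

/-- The run follows the demand model with parameter `θ₀` and the OORMLP policy up to round `T`. -/
structure IsOORMLP [MeasurableSpace Ω] (μ : Measure Ω) (T : ℕ) (W uW lW α : ℝ) : Prop where
  measurable_x : ∀ t ∈ Finset.Icc 1 T, Measurable (R.x t)
  abs_x_le : ∀ t ∈ Finset.Icc 1 T, ∀ᵐ ω ∂μ, ∀ i, |R.x t ω i| ≤ 1
  measurable_η : ∀ t ∈ Finset.Icc 1 T, Measurable (R.η t)
  integrable_η : ∀ t ∈ Finset.Icc 1 T, Integrable (R.η t) μ
  /-- martingale difference noise -/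
  condExp_η : ∀ t ∈ Finset.Icc 1 T, μ[R.η t | R.hist θ₀ t] =ᵐ[μ] 0
  isProbabilityMeasure_law : ∀ t ∈ Finset.Icc 1 T, ∀ ω, IsProbabilityMeasure (R.law t ω)
  measurable_law : ∀ t ∈ Finset.Icc 1 T, ∀ B : Set ℝ, MeasurableSet B →
    Measurable[R.hist θ₀ t] (fun ω => R.law t ω B)
  /-- `law t` is a regular conditional distribution of `η_t` given `ℋ_{t-1}` -/
  law_eq : ∀ t ∈ Finset.Icc 1 T, ∀ B : Set ℝ, MeasurableSet B →
    (fun ω => (R.law t ω).real B) =ᵐ[μ]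
      μ[(R.η t ⁻¹' B).indicator (fun _ => (1 : ℝ)) | R.hist θ₀ t]
  isNoiseLaw : ∀ t ∈ Finset.Icc 1 T, ∀ᵐ ω ∂μ, IsNoiseLaw W uW lW (R.law t ω)
  measurable_p : ∀ t ∈ Finset.Icc 1 T, Measurable (R.p t)
  /-- the initial price is arbitrary within the range of prices -/
  abs_initial_price_le : ∀ᵐ ω ∂μ, |R.p 1 ω| ≤ 2 * W
  measurable_est : ∀ t ∈ Finset.Ico 1 T, Measurable[R.records θ₀ t] (R.est t)
  isLasso_est : ∀ t ∈ Finset.Ico 1 T, ∀ᵐ ω ∂μ, R.IsLasso θ₀ W uW α t ω (R.est t ω)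
  /-- `p_{t+1} = g(⟨θ̂_t, x_{t+1}⟩)` -/
  price_eq : ∀ t ∈ Finset.Ico 1 T, ∀ᵐ ω ∂μ,
    R.p (t + 1) ω = priceFn (R.law (t + 1) ω) (R.est t ω ⬝ᵥ R.x (t + 1) ω)

/-- Restricted eigenvalue process condition with constants `φ_t²` for `n₀ ≤ t ≤ T`. -/
def SatisfiesRE [MeasurableSpace Ω] (μ : Measure Ω) (s₀ n₀ T : ℕ) (φ : ℕ → ℝ) : Prop :=
  ∀ᵐ ω ∂μ, ∀ t ∈ Finset.Icc 1 T, n₀ ≤ t → RestrictedEigenvalueGE s₀ (R.empCov t ω) (φ t ^ 2)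

/-- Conditional revenue loss `𝔼[r_t(p_t*) - r_t(p_t) | ℋ_{t-1}]`. -/
def condLoss [MeasurableSpace Ω] (μ : Measure Ω) (t : ℕ) : Ω → ℝ :=
  μ[R.revenueLoss θ₀ t | R.hist θ₀ t]

/-- `𝔼[‖θ̂ - θ₀‖₂² | ℋ_{t-1}]` for the estimator `θ̂ = θ̂_{t-1}` that prices round `t ≥ 2`. -/
def condSqError [MeasurableSpace Ω] (μ : Measure Ω) (t : ℕ) : Ω → ℝ :=
  μ[fun ω => sqL2 (R.est (t - 1) ω - θ₀) | R.hist θ₀ t]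

/-- Expected regret `𝔼[∑_{t ≤ T} (r_t(p_t*) - r_t(p_t))]` when the true parameter is `θ₀`. -/
def expectedRegret [MeasurableSpace Ω] (μ : Measure Ω) (T : ℕ) : ℝ :=
  ∫ ω, ∑ t ∈ Finset.Icc 1 T, R.revenueLoss θ₀ t ω ∂μ

end Run

/-- Regret over a set `Θ` of true parameters: the supremum over `θ₀ ∈ Θ` of the expected regret of
the run in the market with true parameter `θ₀`. -/
def regret {d : ℕ} (Θ : Set (Fin d → ℝ)) (Ω : (Fin d → ℝ) → Type*)
    [∀ θ, MeasurableSpace (Ω θ)] (μ : ∀ θ, Measure (Ω θ)) (R : ∀ θ, Run d (Ω θ)) (T : ℕ) : EReal :=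
  ⨆ θ₀ ∈ Θ, (((R θ₀).expectedRegret θ₀ (μ θ₀) T : ℝ) : EReal)

end OORMLP

end

noncomputable section

namespace OORMLP

open Set Filter Topology

/-! ### Strongly log-concave functions on an interval -/

section LogConcave

variable {G : ℝ → ℝ} {a b l : ℝ}

/-! The loss of a round is quadratic in the estimation error, and that error has second moment of
order `1 / t`; summing `1 / t` gives the logarithm.

Quadratic loss. Flatness makes the hazard rate increase on `[-3W, 3W]`, so the first order condition
`p * hazard (p - v) = 1` pins down the optimal price `p` and makes it 1-Lipschitz in the mean
valuation `v` (`abs_priceFn_sub_le`). Expected revenue has zero derivative at `p` and a bounded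
second derivative, so mispricing costs at most a multiple of the squared valuation error
(`expRevenue_sub_le`, `condLoss_le`).

Likelihood. Flatness is also strong convexity of the negative log-likelihood. Comparing the
estimator with `θ₀` bounds curvature plus penalty difference by `v ⬝ᵥ S`, with `v` the error and `S`
the sum of the scores (`ae_basic_inequality`). The scores are bounded martingale differences, so
`exp (v ⬝ᵥ S - u² / 2 * gram v)` has mean at most one for each fixed `v` (`integral_expScore_le`).

Second moment. A lasso bound that fails with probability `α` is not enough for the mean, since the
exceptional event could cost a constant in every round. Instead `t * l1 v ^ 2` is bounded pointwise
by variables of bounded mean. In the restricted eigenvalue cone it is controlled by `∑ S_j² / t`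
(`sq_le_of_mem_cone`). Outside the cone there is no curvature bound, but the penalty difference is
at least a multiple of `√t * l1 v`, since singletons in the restricted eigenvalue condition bound
the regularization from below. So either the scores are large, or `√t * l1 v` is bounded, or the
compensated score is large at a lattice point near `√t v`. The last case is handled by summing the
exponentials over the lattice with exponentially decaying weights (`sq_le_of_notMem_cone`). The
constants depend on the dimension, but there is no factor `log t`.

The statement in probability is Markov's inequality for the sum of the squared errors, which are
already known when conditioned on. -/

theorem deriv_log_eq {z : ℝ} (hpos : 0 < G z) (hd : DifferentiableAt ℝ G z) :
    deriv (fun x => Real.log (G x)) z = deriv G z / G z :=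
  (hd.hasDerivAt.log hpos.ne').deriv

/-- The formula `G' / G` for the derivative of `log G` can be differentiated only where it holds in
a neighbourhood, hence the open interval. -/
theorem le_of_flat_log (hpos : ∀ z ∈ Icc a b, 0 < G z)
    (hd : ∀ z ∈ Icc a b, DifferentiableAt ℝ G z)
    (hdd : ∀ z ∈ Icc a b, DifferentiableAt ℝ (deriv G) z)
    (hl : ∀ z ∈ Icc a b, l ≤ -deriv (deriv fun x => Real.log (G x)) z) {z : ℝ}
    (hz : z ∈ Ioo a b) :
    l ≤ (deriv G z * deriv G z - deriv (deriv G) z * G z) / G z ^ 2 := by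
  have hz' := Ioo_subset_Icc_self hz
  have h1 : deriv (fun x => Real.log (G x)) =ᶠ[𝓝 z] fun x => deriv G x / G x := by
    filter_upwards [Ioo_mem_nhds hz.1 hz.2] with x hx
    exact deriv_log_eq (hpos x (Ioo_subset_Icc_self hx)) (hd x (Ioo_subset_Icc_self hx))
  have h2 := ((hdd z hz').hasDerivAt.div (hd z hz').hasDerivAt (hpos z hz').ne').deriv
  have h3 := hl z hz'
  rw [h1.deriv_eq] at h3
  have h4 : deriv (fun x => deriv G x / G x) z = _ := h2
  rw [h4] at h3
  refine h3.trans (le_of_eq ?_)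
  ring

/-- The derivative of `-(G' / G) - l z` is nonnegative in the interior; continuity carries
monotonicity to the endpoints. -/
theorem logDeriv_sub_ge (hpos : ∀ z ∈ Icc a b, 0 < G z)
    (hd : ∀ z ∈ Icc a b, DifferentiableAt ℝ G z)
    (hdd : ∀ z ∈ Icc a b, DifferentiableAt ℝ (deriv G) z)
    (hl : ∀ z ∈ Icc a b, l ≤ -deriv (deriv fun x => Real.log (G x)) z) {x y : ℝ}
    (hx : x ∈ Icc a b) (hy : y ∈ Icc a b) (hxy : x ≤ y) :
    l * (y - x) ≤ deriv G x / G x - deriv G y / G y := by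
  have hD : ∀ z ∈ Icc a b, HasDerivAt (fun z => -(deriv G z / G z) - l * z)
      (-((deriv (deriv G) z * G z - deriv G z * deriv G z) / G z ^ 2) - l * 1) z := fun z hz =>
    (((hdd z hz).hasDerivAt.div (hd z hz).hasDerivAt (hpos z hz).ne').neg).sub
      ((hasDerivAt_id z).const_mul l)
  have hm : MonotoneOn (fun z => -(deriv G z / G z) - l * z) (Icc a b) := by
    refine monotoneOn_of_deriv_nonneg (convex_Icc a b)
      (fun z hz => (hD z hz).continuousAt.continuousWithinAt)
      (fun z hz => (hD z (interior_subset hz)).differentiableAt.differentiableWithinAt) ?_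
    intro z hz
    rw [(hD z (interior_subset hz)).deriv]
    rw [interior_Icc] at hz
    have := le_of_flat_log hpos hd hdd hl hz
    rw [← neg_div]
    have e : -(deriv (deriv G) z * G z - deriv G z * deriv G z) =
      deriv G z * deriv G z - deriv (deriv G) z * G z := by ring
    rw [e]; linarith
  have := hm hx hy hxy
  simp only at this
  linarith

/-- After the quadratic is subtracted, the mean value theorem produces an intermediate slope, which
`logDeriv_sub_ge` compares with the slope at `x`. -/
theorem neg_log_ge (hpos : ∀ z ∈ Icc a b, 0 < G z)
    (hd : ∀ z ∈ Icc a b, DifferentiableAt ℝ G z)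
    (hdd : ∀ z ∈ Icc a b, DifferentiableAt ℝ (deriv G) z)
    (hl : ∀ z ∈ Icc a b, l ≤ -deriv (deriv fun x => Real.log (G x)) z) {x y : ℝ}
    (hx : x ∈ Icc a b) (hy : y ∈ Icc a b) :
    -Real.log (G x) - deriv G x / G x * (y - x) + l / 2 * (y - x) ^ 2 ≤ -Real.log (G y) := by
  have hK : ∀ z ∈ Icc a b, HasDerivAt (fun z => -Real.log (G z) - l / 2 * (z - x) ^ 2)
      (-(deriv G z / G z) - l * (z - x)) z := fun z hz => by
    have h := ((hd z hz).hasDerivAt.log (hpos z hz).ne').neg.sub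
      ((((hasDerivAt_id z).sub_const x).pow 2).const_mul (l / 2))
    refine h.congr_deriv ?_
    simp; ring
  rcases lt_trichotomy x y with h | h | h
  · have hs : Icc x y ⊆ Icc a b := Icc_subset_Icc hx.1 hy.2
    obtain ⟨c, hc, he⟩ := exists_hasDerivAt_eq_slope _ _ h
      (fun z hz => (hK z (hs hz)).continuousAt.continuousWithinAt)
      (fun z hz => hK z (hs (Ioo_subset_Icc_self hz)))
    rw [eq_div_iff (sub_pos.2 h).ne'] at he
    have h1 := logDeriv_sub_ge hpos hd hdd hl hx (hs (Ioo_subset_Icc_self hc)) hc.1.le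
    have h2 := mul_le_mul_of_nonneg_right h1 (sub_pos.2 h).le
    nlinarith
  · subst h; simp
  · have hs : Icc y x ⊆ Icc a b := Icc_subset_Icc hy.1 hx.2
    obtain ⟨c, hc, he⟩ := exists_hasDerivAt_eq_slope _ _ h
      (fun z hz => (hK z (hs hz)).continuousAt.continuousWithinAt)
      (fun z hz => hK z (hs (Ioo_subset_Icc_self hz)))
    rw [eq_div_iff (sub_pos.2 h).ne'] at he
    have h1 := logDeriv_sub_ge hpos hd hdd hl (hs (Ioo_subset_Icc_self hc)) hx hc.2.le
    have h2 := mul_le_mul_of_nonneg_right h1 (sub_pos.2 h).le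
    nlinarith

end LogConcave

/-! ### Noise laws -/

theorem deriv_cdf_nonneg (ν : Measure ℝ) (z : ℝ) : 0 ≤ deriv (cdf ν) z :=
  (monotone_cdf ν).deriv_nonneg

theorem deriv_one_sub_cdf (ν : Measure ℝ) :
    deriv (fun z => 1 - cdf ν z) = fun z => -deriv (cdf ν) z := by
  funext z
  rw [deriv_const_sub]

/-- The hazard rate `f / (1 - F)`. -/
def hazard (ν : Measure ℝ) (z : ℝ) : ℝ := deriv (cdf ν) z / (1 - cdf ν z)

/-- The reversed hazard rate `f / F`. -/
def revHazard (ν : Measure ℝ) (z : ℝ) : ℝ := deriv (cdf ν) z / cdf ν z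

/-- Expected revenue at price `q` for the mean valuation `v`. -/
def expRevenue (ν : Measure ℝ) (v q : ℝ) : ℝ := q * (1 - cdf ν (q - v))

namespace IsNoiseLaw

variable {W uW lW : ℝ} {ν : Measure ℝ} (h : IsNoiseLaw W uW lW ν)
include h

theorem revHazard_le {z : ℝ} (hz : z ∈ Icc (-(3 * W)) (3 * W)) : revHazard ν z ≤ uW := by
  have h1 := (le_iSup₂ (f := fun z (_ : z ∈ Icc (-(3 * W)) (3 * W)) =>
    ((max (deriv (fun a => Real.log (cdf ν a)) z)
      (-deriv (fun a => Real.log (1 - cdf ν a)) z) : ℝ) : EReal)) z hz).trans h.steepness_le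
  rw [EReal.coe_le_coe_iff] at h1
  have h2 := (le_max_left _ _).trans h1
  rwa [deriv_log_eq (h.cdf_pos z hz) (h.differentiable z hz)] at h2

theorem hazard_le {z : ℝ} (hz : z ∈ Icc (-(3 * W)) (3 * W)) : hazard ν z ≤ uW := by
  have h1 := (le_iSup₂ (f := fun z (_ : z ∈ Icc (-(3 * W)) (3 * W)) =>
    ((max (deriv (fun a => Real.log (cdf ν a)) z)
      (-deriv (fun a => Real.log (1 - cdf ν a)) z) : ℝ) : EReal)) z hz).trans h.steepness_le
  rw [EReal.coe_le_coe_iff] at h1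
  have h2 := (le_max_right _ _).trans h1
  rw [deriv_log_eq (G := fun a => 1 - cdf ν a) (sub_pos.2 (h.cdf_lt_one z hz))
    ((h.differentiable z hz).const_sub 1), deriv_one_sub_cdf] at h2
  rw [hazard]
  simpa only [neg_div, neg_neg] using h2

theorem flat_cdf {z : ℝ} (hz : z ∈ Icc (-(3 * W)) (3 * W)) :
    lW ≤ -deriv (deriv fun x => Real.log (cdf ν x)) z := by
  have h1 := h.le_flatness.trans (iInf₂_le (f := fun z (_ : z ∈ Icc (-(3 * W)) (3 * W)) =>
    ((min (-deriv (deriv (fun a => Real.log (cdf ν a))) z)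
      (-deriv (deriv (fun a => Real.log (1 - cdf ν a))) z) : ℝ) : EReal)) z hz)
  rw [EReal.coe_le_coe_iff] at h1
  exact h1.trans (min_le_left _ _)

theorem flat_tail {z : ℝ} (hz : z ∈ Icc (-(3 * W)) (3 * W)) :
    lW ≤ -deriv (deriv fun x => Real.log (1 - cdf ν x)) z := by
  have h1 := h.le_flatness.trans (iInf₂_le (f := fun z (_ : z ∈ Icc (-(3 * W)) (3 * W)) =>
    ((min (-deriv (deriv (fun a => Real.log (cdf ν a))) z)
      (-deriv (deriv (fun a => Real.log (1 - cdf ν a))) z) : ℝ) : EReal)) z hz)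
  rw [EReal.coe_le_coe_iff] at h1
  exact h1.trans (min_le_right _ _)

theorem tail_pos {z : ℝ} (hz : z ∈ Icc (-(3 * W)) (3 * W)) : 0 < 1 - cdf ν z :=
  sub_pos.2 (h.cdf_lt_one z hz)

theorem differentiable_tail {z : ℝ} (hz : z ∈ Icc (-(3 * W)) (3 * W)) :
    DifferentiableAt ℝ (fun x => 1 - cdf ν x) z := (h.differentiable z hz).const_sub 1

theorem differentiable_deriv_tail {z : ℝ} (hz : z ∈ Icc (-(3 * W)) (3 * W)) :
    DifferentiableAt ℝ (deriv fun x => 1 - cdf ν x) z := by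
  rw [deriv_one_sub_cdf]
  exact (h.differentiable_deriv z hz).neg

theorem neg_log_cdf_ge {x y : ℝ} (hx : x ∈ Icc (-(3 * W)) (3 * W))
    (hy : y ∈ Icc (-(3 * W)) (3 * W)) :
    -Real.log (cdf ν x) - revHazard ν x * (y - x) + lW / 2 * (y - x) ^ 2 ≤
      -Real.log (cdf ν y) :=
  neg_log_ge h.cdf_pos h.differentiable h.differentiable_deriv (fun _ => h.flat_cdf) hx hy

theorem neg_log_tail_ge {x y : ℝ} (hx : x ∈ Icc (-(3 * W)) (3 * W))
    (hy : y ∈ Icc (-(3 * W)) (3 * W)) :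
    -Real.log (1 - cdf ν x) + hazard ν x * (y - x) + lW / 2 * (y - x) ^ 2 ≤
      -Real.log (1 - cdf ν y) := by
  have := neg_log_ge (G := fun z => 1 - cdf ν z) (fun _ => h.tail_pos)
    (fun _ => h.differentiable_tail) (fun _ => h.differentiable_deriv_tail)
    (fun _ => h.flat_tail) hx hy
  rw [deriv_one_sub_cdf] at this
  simp only [neg_div] at this
  rw [hazard]; linarith

theorem hazard_sub_ge {x y : ℝ} (hx : x ∈ Icc (-(3 * W)) (3 * W))
    (hy : y ∈ Icc (-(3 * W)) (3 * W)) (hxy : x ≤ y) :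
    lW * (y - x) ≤ hazard ν y - hazard ν x := by
  have := logDeriv_sub_ge (G := fun z => 1 - cdf ν z) (fun _ => h.tail_pos)
    (fun _ => h.differentiable_tail) (fun _ => h.differentiable_deriv_tail)
    (fun _ => h.flat_tail) hx hy hxy
  rw [deriv_one_sub_cdf] at this
  simp only [neg_div] at this
  rw [hazard, hazard]; linarith

theorem hazard_nonneg {z : ℝ} (hz : z ∈ Icc (-(3 * W)) (3 * W)) : 0 ≤ hazard ν z :=
  div_nonneg (deriv_cdf_nonneg ν z) (h.tail_pos hz).le

theorem revHazard_nonneg {z : ℝ} (hz : z ∈ Icc (-(3 * W)) (3 * W)) : 0 ≤ revHazard ν z :=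
  div_nonneg (deriv_cdf_nonneg ν z) (h.cdf_pos z hz).le

/-- The hazard rate is nonnegative at `0` and grows at rate at least `lW`, so it is positive at `W`,
where `uW` dominates it. -/
theorem steepness_pos (hW : 0 < W) (hl : 0 < lW) : 0 < uW := by
  have h0 : (0 : ℝ) ∈ Icc (-(3 * W)) (3 * W) := ⟨by linarith, by linarith⟩
  have h1 : W ∈ Icc (-(3 * W)) (3 * W) := ⟨by linarith, by linarith⟩
  have h2 := h.hazard_sub_ge h0 h1 hW.le
  have h3 := h.hazard_nonneg h0
  have h4 := h.hazard_le h1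
  have h5 : 0 < lW * (W - 0) := by simpa using mul_pos hl hW
  linarith

theorem deriv_cdf_le {z : ℝ} (hz : z ∈ Icc (-(3 * W)) (3 * W)) : deriv (cdf ν) z ≤ uW := by
  refine le_trans ?_ (h.revHazard_le hz)
  rw [revHazard, le_div_iff₀ (h.cdf_pos z hz)]
  exact mul_le_of_le_one_right (deriv_cdf_nonneg ν z) (h.cdf_lt_one z hz).le

/-- Concavity of `log F` gives `f' F ≤ f²`, concavity of `log (1 - F)` gives `-f' (1 - F) ≤ f²`.
Steepness bounds `f` by `uW F` and by `uW (1 - F)`, which cancels the extra factor. -/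
theorem abs_deriv_deriv_cdf_le (hl : 0 < lW) {z : ℝ} (hz : z ∈ Ioo (-(3 * W)) (3 * W)) :
    |deriv (deriv (cdf ν)) z| ≤ uW ^ 2 := by
  have hz' := Ioo_subset_Icc_self hz
  have h1 := le_of_flat_log h.cdf_pos h.differentiable h.differentiable_deriv
    (fun _ => h.flat_cdf) hz
  have h2 := le_of_flat_log (G := fun z => 1 - cdf ν z) (fun _ => h.tail_pos)
    (fun _ => h.differentiable_tail) (fun _ => h.differentiable_deriv_tail)
    (fun _ => h.flat_tail) hz
  have hF := h.cdf_pos z hz'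
  have hF' := h.tail_pos hz'
  have e : deriv (deriv fun x => 1 - cdf ν x) z = -deriv (deriv (cdf ν)) z := by
    rw [deriv_one_sub_cdf]; exact deriv.fun_neg
  rw [e, deriv_one_sub_cdf] at h2
  rw [le_div_iff₀ (by positivity)] at h1 h2
  have h3 := h.revHazard_le hz'
  have h4 := h.hazard_le hz'
  rw [revHazard, div_le_iff₀ hF] at h3
  rw [hazard, div_le_iff₀ hF'] at h4
  have hf := deriv_cdf_nonneg ν z
  have hfu := h.deriv_cdf_le hz'
  have hu : 0 ≤ uW := hf.trans hfu
  set f := deriv (cdf ν) z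
  set F := cdf ν z
  set f' := deriv (deriv (cdf ν)) z
  have p1 : 0 ≤ lW * F ^ 2 := by positivity
  have p2 : 0 ≤ lW * (1 - F) ^ 2 := by positivity
  rw [abs_le]
  constructor
  · have : -f' * (1 - F) ≤ uW ^ 2 * (1 - F) := by
      have : f * f ≤ uW * (uW * (1 - F)) := mul_le_mul hfu h4 hf hu
      nlinarith
    linarith [le_of_mul_le_mul_right this hF']
  · have : f' * F ≤ uW ^ 2 * F := by
      have : f * f ≤ uW * (uW * F) := mul_le_mul hfu h3 hf hu
      nlinarith
    exact le_of_mul_le_mul_right this hF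

/-! ### The optimal price and the revenue around it -/

theorem priceFn_spec {v : ℝ} (hv : v ∈ Icc (-W) W) :
    priceFn ν v - v ∈ densityRegion ν ∧ virtualValue ν (priceFn ν v - v) = -v := by
  have h1 := h.price_exists v hv
  have e : priceFn ν v - v = Function.invFunOn (virtualValue ν) (densityRegion ν) (-v) := by
    rw [priceFn]; ring
  rw [e]
  exact ⟨Function.invFunOn_mem h1, Function.invFunOn_eq h1⟩

theorem priceFn_mem {v : ℝ} (hv : v ∈ Icc (-W) W) : priceFn ν v ∈ Icc 0 (2 * W) := by
  refine ⟨?_, h.price_le v hv⟩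
  obtain ⟨h1, h2⟩ := h.priceFn_spec hv
  rw [virtualValue] at h2
  have : 0 ≤ (1 - cdf ν (priceFn ν v - v)) / deriv (cdf ν) (priceFn ν v - v) :=
    div_nonneg (sub_pos.2 h1.2.1).le h1.2.2.le
  linarith

theorem priceFn_sub_mem (hW : 0 < W) {v : ℝ} (hv : v ∈ Icc (-W) W) :
    priceFn ν v - v ∈ Icc (-(3 * W)) (3 * W) := by
  have h1 := h.priceFn_mem hv
  exact ⟨by linarith [h1.1, hv.2], by linarith [h1.2, hv.1]⟩

/-- First order condition of the optimal price. -/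
theorem priceFn_mul_deriv {v : ℝ} (hv : v ∈ Icc (-W) W) :
    1 - cdf ν (priceFn ν v - v) = priceFn ν v * deriv (cdf ν) (priceFn ν v - v) := by
  obtain ⟨h1, h2⟩ := h.priceFn_spec hv
  rw [virtualValue, sub_eq_iff_eq_add, ← sub_eq_iff_eq_add', eq_div_iff h1.2.2.ne'] at h2
  rw [← h2]; ring

/-- The criterion reads `1 ≤ (z + v) * hazard z`, with equality at the optimal noise level, and the
hazard rate is increasing. Unlike the inverse of the virtual valuation, it depends visibly
measurably on the law. -/
theorem priceFn_sub_le_iff (hW : 0 < W) (hl : 0 < lW) {v z : ℝ} (hv : v ∈ Icc (-W) W)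
    (hz : z ∈ Icc (-(3 * W)) (3 * W)) :
    priceFn ν v - v ≤ z ↔ 1 - cdf ν z ≤ (z + v) * deriv (cdf ν) z := by
  have hmem := h.priceFn_sub_mem hW hv
  have h1 := h.priceFn_mul_deriv hv
  have hT := h.tail_pos hmem
  have hTz := h.tail_pos hz
  have h2 : 1 = priceFn ν v * hazard ν (priceFn ν v - v) := by
    rw [hazard, ← mul_div_assoc, ← h1, div_self hT.ne']
  have h3 : (1 - cdf ν z ≤ (z + v) * deriv (cdf ν) z) ↔ 1 ≤ (z + v) * hazard ν z := by
    rw [hazard, ← mul_div_assoc, le_div_iff₀ hTz, one_mul]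
  rw [h3]
  have hp := h.priceFn_mem hv
  have hh := h.hazard_nonneg hmem
  have hhz := h.hazard_nonneg hz
  constructor
  · intro hle
    rw [h2]
    have := h.hazard_sub_ge hmem hz hle
    have h5 : 0 ≤ lW * (z - (priceFn ν v - v)) := mul_nonneg hl.le (by linarith)
    exact mul_le_mul (by linarith) (by linarith) hh (by linarith [hp.1])
  · intro hle
    by_contra! hlt
    have := h.hazard_sub_ge hz hmem hlt.le
    have h5 : 0 < lW * (priceFn ν v - v - z) := mul_pos hl (by linarith)
    have h6 : (z + v) * hazard ν z ≤ priceFn ν v * hazard ν z :=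
      mul_le_mul_of_nonneg_right (by linarith) hhz
    have h7 : 0 < priceFn ν v := by
      rcases hp.1.lt_or_eq with h | h
      · exact h
      · rw [← h] at h2; simp at h2
    nlinarith

/-- A larger valuation lowers the optimal noise level, hence the hazard rate there. Price times
hazard rate is one, so the price rises. Together the two monotonicities give the Lipschitz constant
one. -/
theorem priceFn_sub_anti (hW : 0 < W) (hl : 0 < lW) {v w : ℝ} (hv : v ∈ Icc (-W) W)
    (hw : w ∈ Icc (-W) W) (hvw : v ≤ w) :
    priceFn ν w - w ≤ priceFn ν v - v ∧ priceFn ν v ≤ priceFn ν w := by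
  have hmv := h.priceFn_sub_mem hW hv
  have hmw := h.priceFn_sub_mem hW hw
  have hf := deriv_cdf_nonneg ν (priceFn ν v - v)
  have h1 : priceFn ν w - w ≤ priceFn ν v - v := by
    rw [h.priceFn_sub_le_iff hW hl hw hmv, h.priceFn_mul_deriv hv]
    exact mul_le_mul_of_nonneg_right (by linarith) hf
  refine ⟨h1, ?_⟩
  have h2 := h.hazard_sub_ge hmw hmv h1
  have e : ∀ {v}, v ∈ Icc (-W) W → 1 = priceFn ν v * hazard ν (priceFn ν v - v) := by
    intro v hv
    rw [hazard, ← mul_div_assoc, ← h.priceFn_mul_deriv hv,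
      div_self (h.tail_pos (h.priceFn_sub_mem hW hv)).ne']
  have hp := h.priceFn_mem hw
  by_contra! hlt
  have h5 : 0 ≤ lW * (priceFn ν v - v - (priceFn ν w - w)) := mul_nonneg hl.le (by linarith)
  have ev := e hv
  have ew := e hw
  have hhw : 0 < hazard ν (priceFn ν w - w) := by
    rcases (h.hazard_nonneg hmw).lt_or_eq with h | h
    · exact h
    · rw [← h] at ew; simp at ew
  have : priceFn ν w * hazard ν (priceFn ν w - w) < priceFn ν v * hazard ν (priceFn ν v - v) :=
    mul_lt_mul hlt (by linarith) hhw (by linarith [hp.1])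
  linarith

theorem abs_priceFn_sub_le (hW : 0 < W) (hl : 0 < lW) {v w : ℝ} (hv : v ∈ Icc (-W) W)
    (hw : w ∈ Icc (-W) W) : |priceFn ν v - priceFn ν w| ≤ |v - w| := by
  rcases le_total v w with hvw | hvw
  · have := h.priceFn_sub_anti hW hl hv hw hvw
    rw [abs_sub_comm, abs_sub_comm v, abs_of_nonneg (by linarith), abs_of_nonneg (by linarith)]
    linarith
  · have := h.priceFn_sub_anti hW hl hw hv hvw
    rw [abs_of_nonneg (by linarith), abs_of_nonneg (by linarith)]
    linarith

/-- The expected revenue is quadratic around the optimal price. -/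
theorem expRevenue_sub_le (hW : 0 < W) (hl : 0 < lW) {v q : ℝ} (hv : v ∈ Icc (-W) W)
    (hq : q ∈ Icc 0 (2 * W)) :
    expRevenue ν v (priceFn ν v) - expRevenue ν v q ≤
      (2 * uW + 2 * W * uW ^ 2) * (priceFn ν v - q) ^ 2 := by
  set p := priceFn ν v with hp
  have hpm : p ∈ Icc 0 (2 * W) := h.priceFn_mem hv
  -- `B` bounds the second derivative `-2 f - q f'` of the expected revenue for prices `q` up to
  -- `2W`.
  set B := 2 * uW + 2 * W * uW ^ 2
  have hu := h.steepness_pos hW hl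
  have hsub : ∀ r ∈ Icc 0 (2 * W), r - v ∈ Icc (-(3 * W)) (3 * W) := fun r hr =>
    ⟨by linarith [hr.1, hv.2], by linarith [hr.2, hv.1]⟩
  have hD : ∀ r ∈ Icc 0 (2 * W), HasDerivAt (expRevenue ν v)
      (1 - cdf ν (r - v) - r * deriv (cdf ν) (r - v)) r := by
    intro r hr
    have h1 := ((h.differentiable _ (hsub r hr)).hasDerivAt.comp_sub_const r v).const_sub 1
    refine ((hasDerivAt_id r).mul h1).congr_deriv ?_
    simp; ring
  have hDD : ∀ r ∈ Icc 0 (2 * W),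
      HasDerivAt (fun r => 1 - cdf ν (r - v) - r * deriv (cdf ν) (r - v))
      (-(2 * deriv (cdf ν) (r - v)) - r * deriv (deriv (cdf ν)) (r - v)) r := by
    intro r hr
    have h1 := ((h.differentiable _ (hsub r hr)).hasDerivAt.comp_sub_const r v).const_sub 1
    have h2 := (h.differentiable_deriv _ (hsub r hr)).hasDerivAt.comp_sub_const r v
    refine (h1.sub ((hasDerivAt_id r).mul h2)).congr_deriv ?_
    simp; ring
  have hconv : ∀ s ∈ Ioo 0 (2 * W), ‖deriv (fun r => 1 - cdf ν (r - v) -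
      r * deriv (cdf ν) (r - v)) s‖ ≤ B := by
    intro s hs
    have hs' := Ioo_subset_Icc_self hs
    rw [(hDD s hs').deriv, Real.norm_eq_abs]
    have h1 := h.deriv_cdf_le (hsub s hs')
    have h2 := h.abs_deriv_deriv_cdf_le hl (z := s - v)
      ⟨by linarith [hs.1, hv.2], by linarith [hs.2, hv.1]⟩
    have h3 := deriv_cdf_nonneg ν (s - v)
    have h4 : |s * deriv (deriv (cdf ν)) (s - v)| ≤ 2 * W * uW ^ 2 := by
      rw [abs_mul, abs_of_nonneg hs'.1]
      exact mul_le_mul hs'.2 h2 (abs_nonneg _) (by positivity)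
    have h5 := abs_le.1 h4
    rw [abs_le]
    constructor <;> simp only [B] <;> linarith [h5.1, h5.2]
  have hB : 0 ≤ B := by positivity
  have hR' : ∀ r ∈ Icc 0 (2 * W), |1 - cdf ν (r - v) - r * deriv (cdf ν) (r - v)| ≤
      B * |p - r| := by
    have key : ∀ a ∈ Icc 0 (2 * W), ∀ b ∈ Icc 0 (2 * W), a < b →
        |(1 - cdf ν (b - v) - b * deriv (cdf ν) (b - v)) -
          (1 - cdf ν (a - v) - a * deriv (cdf ν) (a - v))| ≤ B * |b - a| := by
      intro a ha b hb hab
      have hs : Icc a b ⊆ Icc 0 (2 * W) := Icc_subset_Icc ha.1 hb.2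
      obtain ⟨c, hc, he⟩ := exists_deriv_eq_slope
        (fun r => 1 - cdf ν (r - v) - r * deriv (cdf ν) (r - v)) hab
        (fun z hz => (hDD z (hs hz)).continuousAt.continuousWithinAt)
        (fun z hz => (hDD z (hs (Ioo_subset_Icc_self hz))).differentiableAt.differentiableWithinAt)
      have h1 := hconv c ⟨lt_of_le_of_lt ha.1 hc.1, lt_of_lt_of_le hc.2 hb.2⟩
      rw [eq_div_iff (sub_pos.2 hab).ne'] at he
      rw [← he, abs_mul]
      exact mul_le_mul_of_nonneg_right h1 (abs_nonneg _)
    intro r hr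
    have hp0 : 1 - cdf ν (p - v) - p * deriv (cdf ν) (p - v) = 0 := by
      rw [hp, h.priceFn_mul_deriv hv, sub_self]
    rcases lt_trichotomy p r with hlt | heq | hlt
    · have := key p hpm r hr hlt
      rwa [hp0, sub_zero, abs_sub_comm r p] at this
    · rw [← heq, hp0]; simp
    · have := key r hr p hpm hlt
      rwa [hp0, zero_sub, abs_neg] at this
  -- The first derivative vanishes at `p`, so between `q` and `p` it is at most `B |p - q|`; a
  -- second mean value estimate gives the square.
  have hfin : ‖expRevenue ν v p - expRevenue ν v q‖ ≤ B * |p - q| * ‖p - q‖ := by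
    have hs : uIcc q p ⊆ Icc 0 (2 * W) := uIcc_subset_Icc hq hpm
    refine Convex.norm_image_sub_le_of_norm_hasDerivWithin_le (s := uIcc q p)
      (f' := fun r => 1 - cdf ν (r - v) - r * deriv (cdf ν) (r - v))
      (fun r hr => (hD r (hs hr)).hasDerivWithinAt) (fun r hr => ?_) (convex_uIcc q p)
      left_mem_uIcc right_mem_uIcc
    refine (hR' r (hs hr)).trans (mul_le_mul_of_nonneg_left ?_ hB)
    exact abs_sub_right_of_mem_uIcc hr
  rw [Real.norm_eq_abs, Real.norm_eq_abs, mul_assoc, ← sq, sq_abs] at hfin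
  exact (le_abs_self _).trans hfin

end IsNoiseLaw

/-! ### Random laws -/

section RandomLaw

variable {Ω : Type*} {m : MeasurableSpace Ω} {law : Ω → Measure ℝ}

theorem measurable_law_section (hp : ∀ ω, IsProbabilityMeasure (law ω))
    (hl : ∀ B : Set ℝ, MeasurableSet B → Measurable fun ω => law ω B) {S : Set (Ω × ℝ)}
    (hS : MeasurableSet S) : Measurable fun ω => law ω (Prod.mk ω ⁻¹' S) := by
  let κ : Kernel Ω ℝ := ⟨law, Measure.measurable_of_measurable_coe _ hl⟩
  have : IsMarkovKernel κ := ⟨hp⟩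
  exact Kernel.measurable_kernel_prodMk_left (κ := κ) hS

theorem measurable_cdf_comp (hp : ∀ ω, IsProbabilityMeasure (law ω))
    (hl : ∀ B : Set ℝ, MeasurableSet B → Measurable fun ω => law ω B) {z : Ω → ℝ}
    (hz : Measurable z) : Measurable fun ω => cdf (law ω) (z ω) := by
  have h1 := measurable_law_section hp hl (S := {q | q.2 ≤ z q.1})
    (measurableSet_le measurable_snd (hz.comp measurable_fst))
  have : (fun ω => cdf (law ω) (z ω)) =
      fun ω => (law ω (Prod.mk ω ⁻¹' {q : Ω × ℝ | q.2 ≤ z q.1})).toReal := by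
    funext ω
    have := hp ω
    rw [cdf_eq_real]; rfl
  rw [this]
  exact h1.ennreal_toReal

/-- The upper right derivative of `F` along the sequence `1 / (n + 1)`, which is a density
depending measurably on random laws. -/
def upperDensity (ν : Measure ℝ) (z : ℝ) : ℝ :=
  limsup (fun n : ℕ => (cdf ν (z + 1 / ((n : ℝ) + 1)) - cdf ν z) / (1 / ((n : ℝ) + 1))) atTop

theorem upperDensity_eq {ν : Measure ℝ} {z : ℝ} (h : DifferentiableAt ℝ (cdf ν) z) :
    upperDensity ν z = deriv (cdf ν) z := by
  have h1 := h.hasDerivAt.tendsto_slope_zero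
  have h2 : Tendsto (fun n : ℕ => 1 / ((n : ℝ) + 1)) atTop (𝓝[≠] 0) :=
    tendsto_nhdsWithin_iff.2 ⟨tendsto_one_div_add_atTop_nhds_zero_nat,
      Eventually.of_forall fun n => by simp; positivity⟩
  refine Tendsto.limsup_eq ((h1.comp h2).congr fun n => ?_)
  exact (div_eq_inv_mul _ _).symm

theorem measurable_upperDensity_comp (hp : ∀ ω, IsProbabilityMeasure (law ω))
    (hl : ∀ B : Set ℝ, MeasurableSet B → Measurable fun ω => law ω B) {z : Ω → ℝ}
    (hz : Measurable z) : Measurable fun ω => upperDensity (law ω) (z ω) :=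
  Measurable.limsup fun _ =>
    ((measurable_cdf_comp hp hl (hz.add_const _)).sub (measurable_cdf_comp hp hl hz)).div_const _

/-- A sale includes equality, while `1 - F` is the mass strictly above `z`; continuity of `F`
removes the atom. -/
theorem real_Ici_eq {ν : Measure ℝ} [IsProbabilityMeasure ν] {z : ℝ}
    (h : ContinuousAt (cdf ν) z) : ν.real (Ici z) = 1 - cdf ν z := by
  have h0 : ν {z} = 0 := by
    conv_lhs => rw [← measure_cdf ν]
    rw [StieltjesFunction.measure_singleton, (h.continuousWithinAt).leftLim_eq]
    simp
  have h1 : ν.real (Iic z) = ν.real (Iio z) := by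
    rw [measureReal_def, measureReal_def, ← Iio_union_right]
    congr 1
    refine le_antisymm ((measure_union_le _ _).trans ?_) (measure_mono subset_union_left)
    rw [h0, add_zero]
  rw [cdf_eq_real, h1, ← compl_Iio, probReal_compl_eq_one_sub measurableSet_Iio]

/-- Disintegration of the joint law of `X` and `Y` from its values on rectangles. -/
theorem measure_prodMk_mem_eq_lintegral {Ω β : Type*} [MeasurableSpace Ω] [MeasurableSpace β]
    {μ : Measure Ω} [IsProbabilityMeasure μ] {X : Ω → β} (hX : Measurable X) {Y : Ω → ℝ}
    (hY : Measurable Y) (κ : Kernel β ℝ) [IsMarkovKernel κ]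
    (h : ∀ A B, MeasurableSet A → MeasurableSet B →
      μ (X ⁻¹' A ∩ Y ⁻¹' B) = ∫⁻ ω in X ⁻¹' A, κ (X ω) B ∂μ) {S : Set (β × ℝ)}
    (hS : MeasurableSet S) :
    μ {ω | (X ω, Y ω) ∈ S} = ∫⁻ ω, κ (X ω) (Prod.mk (X ω) ⁻¹' S) ∂μ := by
  have hpair : Measurable fun ω => (X ω, Y ω) := hX.prodMk hY
  have := Measure.isProbabilityMeasure_map (μ := μ) hpair.aemeasurable
  have key : μ.map (fun ω => (X ω, Y ω)) = μ.map X ⊗ₘ κ := by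
    refine Measure.ext_prod fun {A B} hA hB => ?_
    rw [Measure.compProd_apply_prod hA hB, Measure.map_apply hpair (hA.prod hB),
      setLIntegral_map hA (κ.measurable_coe hB) hX, ← h A B hA hB]
    rfl
  have h1 := Measure.map_apply (μ := μ) hpair hS
  rw [key, Measure.compProd_apply hS,
    lintegral_map (Kernel.measurable_kernel_prodMk_left hS) hX] at h1
  exact h1.symm

variable {m0 : MeasurableSpace Ω} {μ : Measure[m0] Ω} [IsProbabilityMeasure μ]

/-- The disintegrated pair is `(ω, η ω)` with the coarse σ-algebra on the first factor, so sections
may involve any quantity known to the history. -/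
theorem measure_mem_eq_lintegral (hm : m ≤ m0) {η : Ω → ℝ} (hη : Measurable[m0] η)
    (hp : ∀ ω, IsProbabilityMeasure (law ω))
    (hl : ∀ B : Set ℝ, MeasurableSet B → Measurable[m] fun ω => law ω B)
    (h : ∀ A B, MeasurableSet[m] A → MeasurableSet B →
      μ (A ∩ η ⁻¹' B) = ∫⁻ ω in A, law ω B ∂μ) {S : Set (Ω × ℝ)}
    (hS : MeasurableSet[m.prod inferInstance] S) :
    μ {ω | (ω, η ω) ∈ S} = ∫⁻ ω, law ω (Prod.mk ω ⁻¹' S) ∂μ := by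
  let κ : @Kernel Ω ℝ m _ := @Kernel.mk Ω ℝ m _ law (Measure.measurable_of_measurable_coe _ hl)
  have : @IsMarkovKernel Ω ℝ m _ κ := @IsMarkovKernel.mk Ω ℝ m _ κ hp
  exact @measure_prodMk_mem_eq_lintegral Ω Ω m0 m μ _ id (measurable_id'' hm) η hη κ this h S hS

/-- If `law` is a regular conditional distribution of `η` given `m`, it also disintegrates events
which depend on `η` and on `m`-measurable quantities. -/
theorem law_real_eq_condExp (hm : m ≤ m0) {η : Ω → ℝ} (hη : Measurable[m0] η)
    (hp : ∀ ω, IsProbabilityMeasure (law ω))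
    (hl : ∀ B : Set ℝ, MeasurableSet B → Measurable[m] fun ω => law ω B)
    (h : ∀ B, MeasurableSet B → (fun ω => (law ω).real B) =ᵐ[μ]
      μ[(η ⁻¹' B).indicator (fun _ => (1 : ℝ)) | m]) {q : Ω → ℝ} (hq : Measurable[m] q) :
    (fun ω => (law ω).real (Ici (q ω))) =ᵐ[μ]
      μ[{ω | q ω ≤ η ω}.indicator (fun _ => (1 : ℝ)) | m] := by
  -- Integrating the conditional law over known events gives its values on rectangles; these
  -- determine the joint law and so allow a random threshold.
  have hrect : ∀ A B, MeasurableSet[m] A → MeasurableSet B →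
      μ (A ∩ η ⁻¹' B) = ∫⁻ ω in A, law ω B ∂μ := by
    intro A B hA hB
    have hi : Integrable ((η ⁻¹' B).indicator fun _ => (1 : ℝ)) μ :=
      (integrable_const 1).indicator (hη hB)
    have h1 := setIntegral_condExp hm hi hA
    rw [← setIntegral_congr_ae (hm _ hA) ((h B hB).mono fun ω hω _ => hω),
      setIntegral_indicator (hη hB)] at h1
    have h2 : ∫⁻ ω in A, law ω B ∂μ = ENNReal.ofReal (∫ ω in A, (law ω).real B ∂μ) := by
      rw [ofReal_integral_eq_lintegral_ofReal]
      · refine lintegral_congr fun ω => ?_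
        have := hp ω
        rw [measureReal_def, ENNReal.ofReal_toReal (measure_ne_top _ _)]
      · have : Integrable (fun ω => (law ω).real B) μ :=
          integrable_condExp.congr (h B hB).symm
        exact this.integrableOn
      · exact Eventually.of_forall fun ω => measureReal_nonneg
    rw [h2, h1]
    simp
  have hqS : ∀ A, MeasurableSet[m] A → μ (A ∩ {ω | q ω ≤ η ω}) =
      ∫⁻ ω in A, law ω (Ici (q ω)) ∂μ := by
    intro A hA
    have hS1 : MeasurableSet[m.prod inferInstance] {r : Ω × ℝ | q r.1 ≤ r.2} :=
      @measurableSet_le _ _ _ _ _ (m.prod inferInstance) _ _ _ _ _ (hq.comp (@measurable_fst _ _ m _))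
        (@measurable_snd _ _ m _)
    have hS : MeasurableSet[m.prod inferInstance]
        ((Prod.fst : Ω × ℝ → Ω) ⁻¹' A ∩ {r : Ω × ℝ | q r.1 ≤ r.2}) :=
      @MeasurableSet.inter _ (m.prod inferInstance) _ _ ((@measurable_fst _ _ m _) hA) hS1
    have h1 := measure_mem_eq_lintegral hm hη hp hl hrect hS
    refine h1.trans ?_
    rw [← lintegral_indicator (hm _ hA)]
    refine lintegral_congr fun ω => ?_
    by_cases hω : ω ∈ A
    · rw [indicator_of_mem hω]
      congr 1
      ext y; simp [hω]
    · rw [indicator_of_notMem hω]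
      convert measure_empty (μ := law ω)
      ext y; simp [hω]
  have hqm : Measurable[m0] q := hq.mono hm le_rfl
  have hms : MeasurableSet[m0] {ω | q ω ≤ η ω} := measurableSet_le hqm hη
  have hi : Integrable ({ω | q ω ≤ η ω}.indicator fun _ => (1 : ℝ)) μ :=
    (integrable_const 1).indicator hms
  have hmeas : Measurable[m] fun ω => (law ω).real (Ici (q ω)) :=
    (measurable_law_section hp hl (S := {r : Ω × ℝ | q r.1 ≤ r.2})
      (@measurableSet_le _ _ _ _ _ (m.prod inferInstance) _ _ _ _ _
        (hq.comp (@measurable_fst _ _ m _)) (@measurable_snd _ _ m _))).ennreal_toReal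
  have hint : Integrable (fun ω => (law ω).real (Ici (q ω))) μ := by
    refine Integrable.of_bound (hmeas.mono hm le_rfl).aestronglyMeasurable 1
      (Eventually.of_forall fun ω => ?_)
    have := hp ω
    rw [Real.norm_eq_abs, abs_of_nonneg measureReal_nonneg]
    exact measureReal_le_one
  refine ae_eq_condExp_of_forall_setIntegral_eq hm hi (fun A _ _ => hint.integrableOn) ?_
    hmeas.stronglyMeasurable.aestronglyMeasurable
  intro A hA _
  rw [setIntegral_indicator hms]
  have e : ENNReal.ofReal (∫ ω in A, (law ω).real (Ici (q ω)) ∂μ) =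
      μ (A ∩ {ω | q ω ≤ η ω}) := by
    rw [hqS A hA, ofReal_integral_eq_lintegral_ofReal hint.integrableOn
      (Eventually.of_forall fun ω => measureReal_nonneg)]
    refine lintegral_congr fun ω => ?_
    have := hp ω
    rw [measureReal_def, ENNReal.ofReal_toReal (measure_ne_top _ _)]
  rw [setIntegral_const, smul_eq_mul, mul_one, measureReal_def, ← e, ENNReal.toReal_ofReal]
  exact integral_nonneg fun ω => measureReal_nonneg

omit [IsProbabilityMeasure μ] in
/-- The optimal price is almost surely a measurable function of the law and the mean valuation. -/
theorem exists_measurable_priceFn {W uW lW : ℝ} (hW : 0 < W) (hlW : 0 < lW)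
    (hp : ∀ ω, IsProbabilityMeasure (law ω))
    (hl : ∀ B : Set ℝ, MeasurableSet B → Measurable[m] fun ω => law ω B)
    (hN : ∀ᵐ ω ∂μ, IsNoiseLaw W uW lW (law ω)) {v : Ω → ℝ} (hv : Measurable[m] v)
    (hvW : ∀ᵐ ω ∂μ, v ω ∈ Icc (-W) W) :
    ∃ p : Ω → ℝ, Measurable[m] p ∧ p =ᵐ[μ] fun ω => priceFn (law ω) (v ω) := by
  classical
  -- `priceFn` chooses a preimage, so measurability comes from another formula: the optimal noise
  -- level is the infimum of the rationals that pass the criterion of `priceFn_sub_le_iff`. A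
  -- rational that fails contributes `3W`, which is never below that level.
  let I : Set ℚ := {c | (c : ℝ) ∈ Icc (-(3 * W)) (3 * W)}
  let cond : I → Set Ω := fun c =>
    {ω | 1 - cdf (law ω) (c : ℚ) ≤ ((c : ℚ) + v ω) * upperDensity (law ω) (c : ℚ)}
  let g : I → Ω → ℝ := fun c => (cond c).piecewise (fun _ => ((c : ℚ) : ℝ)) (fun _ => 3 * W)
  have : Nonempty I := ⟨⟨0, by simp [I]; linarith⟩⟩
  refine ⟨fun ω => v ω + ⨅ c, g c ω, hv.add (Measurable.iInf fun c => ?_), ?_⟩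
  · refine Measurable.piecewise ?_ measurable_const measurable_const
    exact measurableSet_le ((measurable_cdf_comp hp hl measurable_const).const_sub _)
      ((hv.const_add _).mul (measurable_upperDensity_comp hp hl measurable_const))
  · filter_upwards [hN, hvW] with ω h hω
    have hmem := h.priceFn_sub_mem hW hω
    have hc : ∀ c : I, ω ∈ cond c ↔ priceFn (law ω) (v ω) - v ω ≤ (c : ℚ) := fun c => by
      rw [h.priceFn_sub_le_iff hW hlW hω c.2, ← upperDensity_eq (h.differentiable _ c.2)]
      rfl
    have hg : ∀ c : I, priceFn (law ω) (v ω) - v ω ≤ g c ω := fun c => by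
      by_cases hcω : ω ∈ cond c
      · rw [show g c ω = _ from piecewise_eq_of_mem _ _ _ hcω]; exact (hc c).1 hcω
      · rw [show g c ω = _ from piecewise_eq_of_notMem _ _ _ hcω]; exact hmem.2
    rw [← eq_sub_iff_add_eq']
    refine le_antisymm (le_of_forall_gt_imp_ge_of_dense fun b hb => ?_) (le_ciInf hg)
    have hbdd : BddBelow (range fun c => g c ω) := ⟨_, by rintro _ ⟨c, rfl⟩; exact hg c⟩
    rcases le_or_gt b (3 * W) with hb3 | hb3
    · obtain ⟨c, hc1, hc2⟩ := exists_rat_btwn hb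
      have hcI : c ∈ I := ⟨hmem.1.trans hc1.le, hc2.le.trans hb3⟩
      refine (ciInf_le hbdd ⟨c, hcI⟩).trans ?_
      have hcω : ω ∈ cond ⟨c, hcI⟩ := (hc ⟨c, hcI⟩).2 hc1.le
      rw [show g ⟨c, hcI⟩ ω = _ from piecewise_eq_of_mem _ _ _ hcω]
      exact hc2.le
    · obtain ⟨c⟩ := (inferInstance : Nonempty I)
      refine (ciInf_le hbdd c).trans ?_
      by_cases hcω : ω ∈ cond c
      · rw [show g c ω = _ from piecewise_eq_of_mem _ _ _ hcω]; exact c.2.2.trans hb3.le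
      · rw [show g c ω = _ from piecewise_eq_of_notMem _ _ _ hcω]; exact hb3.le

end RandomLaw

/-! ### Elementary facts on `ℓ₁` and `ℓ₂` norms -/

section Norms

variable {d : ℕ}

theorem l1_nonneg (v : Fin d → ℝ) : 0 ≤ l1 v := Finset.sum_nonneg fun _ _ => abs_nonneg _

theorem sqL2_nonneg (v : Fin d → ℝ) : 0 ≤ sqL2 v := Finset.sum_nonneg fun _ _ => sq_nonneg _

theorem l1_sub_le (v w : Fin d → ℝ) : l1 (v - w) ≤ l1 v + l1 w := by
  rw [l1, l1, l1, ← Finset.sum_add_distrib]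
  exact Finset.sum_le_sum fun i _ => abs_sub _ _

theorem abs_dotProduct_le {v x : Fin d → ℝ} (hx : ∀ i, |x i| ≤ 1) : |v ⬝ᵥ x| ≤ l1 v := by
  refine (Finset.abs_sum_le_sum_abs _ _).trans (Finset.sum_le_sum fun i _ => ?_)
  rw [abs_mul]
  exact mul_le_of_le_one_right (abs_nonneg _) (hx i)

theorem l1_sq_le (v : Fin d → ℝ) : l1 v ^ 2 ≤ d * sqL2 v := by
  have := sq_sum_le_card_mul_sum_sq (s := Finset.univ) (f := fun i => |v i|)
  simpa [l1, sqL2] using this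

theorem sqL2_le_l1_sq (v : Fin d → ℝ) : sqL2 v ≤ l1 v ^ 2 := by
  have := Finset.sum_sq_le_sq_sum_of_nonneg (s := Finset.univ) (f := fun i => |v i|)
    (fun i _ => abs_nonneg _)
  simpa [l1, sqL2] using this

end Norms

/-! ### Histories, thresholds and prices in a run -/

namespace Run

variable {d : ℕ} {Ω : Type*} (R : Run d Ω) (θ₀ : Fin d → ℝ)

theorem records_mono {s t : ℕ} (h : s ≤ t) : R.records θ₀ s ≤ R.records θ₀ t :=
  biSup_mono fun _ hi => Finset.Icc_subset_Icc_right h hi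

theorem records_le_hist {s t : ℕ} (h : s < t) : R.records θ₀ s ≤ R.hist θ₀ t :=
  (R.records_mono θ₀ (Nat.le_sub_one_of_lt h)).trans (le_sup_left.trans le_sup_left)

theorem measurable_x_hist (t : ℕ) : Measurable[R.hist θ₀ t] (R.x t) :=
  measurable_iff_comap_le.2 (le_sup_right.trans le_sup_left)

theorem measurable_p_hist (t : ℕ) : Measurable[R.hist θ₀ t] (R.p t) :=
  measurable_iff_comap_le.2 le_sup_right

theorem round_le_records {t : ℕ} (ht : 1 ≤ t) :
    (MeasurableSpace.comap (R.x t) inferInstance ⊔ MeasurableSpace.comap (R.p t) inferInstance ⊔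
      MeasurableSpace.comap (R.sale θ₀ t) inferInstance) ≤ R.records θ₀ t :=
  le_iSup₂ (f := fun s (_ : s ∈ Finset.Icc 1 t) =>
    (MeasurableSpace.comap (R.x s) inferInstance ⊔
    MeasurableSpace.comap (R.p s) inferInstance ⊔
    MeasurableSpace.comap (R.sale θ₀ s) inferInstance)) t (Finset.mem_Icc.2 ⟨ht, le_rfl⟩)

theorem measurable_sale_records {t : ℕ} (ht : 1 ≤ t) :
    Measurable[R.records θ₀ t] (R.sale θ₀ t) :=
  measurable_iff_comap_le.2 (le_sup_right.trans (R.round_le_records θ₀ ht))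

theorem hist_le_records {t : ℕ} (ht : 1 ≤ t) : R.hist θ₀ t ≤ R.records θ₀ t :=
  sup_le (sup_le (R.records_mono θ₀ (Nat.sub_le t 1))
    (le_sup_left.trans (le_sup_left.trans (R.round_le_records θ₀ ht))))
    (le_sup_right.trans (le_sup_left.trans (R.round_le_records θ₀ ht)))

/-- The noise level above which the product is sold in round `t`. -/
def cutoff (t : ℕ) (ω : Ω) : ℝ := R.p t ω - θ₀ ⬝ᵥ R.x t ω

theorem measurable_dot_hist (v : Fin d → ℝ) (t : ℕ) :
    Measurable[R.hist θ₀ t] fun ω => v ⬝ᵥ R.x t ω := by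
  have h := R.measurable_x_hist θ₀ t
  exact Finset.measurable_sum _ fun i _ => ((measurable_pi_apply i).comp h).const_mul (v i)

theorem measurable_cutoff (t : ℕ) : Measurable[R.hist θ₀ t] (R.cutoff θ₀ t) :=
  (R.measurable_p_hist θ₀ t).sub (R.measurable_dot_hist θ₀ θ₀ t)

theorem sale_eq_one_iff (t : ℕ) (ω : Ω) : R.sale θ₀ t ω = 1 ↔ R.cutoff θ₀ t ω ≤ R.η t ω := by
  rw [sale, cutoff, valuation, sub_le_iff_le_add']
  split_ifs with h <;> simp [h]

/-- The derivative of the negative log-likelihood of round `t` in `-⟨θ, x_t⟩` at `θ = θ₀`. -/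
def score (t : ℕ) (ω : Ω) : ℝ :=
  if R.sale θ₀ t ω = 1 then
    upperDensity (R.law t ω) (R.cutoff θ₀ t ω) / (1 - cdf (R.law t ω) (R.cutoff θ₀ t ω))
  else -(upperDensity (R.law t ω) (R.cutoff θ₀ t ω) / cdf (R.law t ω) (R.cutoff θ₀ t ω))

namespace IsOORMLP

variable {R θ₀} [m0 : MeasurableSpace Ω] {μ : Measure Ω} [IsProbabilityMeasure μ] {T : ℕ}
  {W uW lW α : ℝ} (h : R.IsOORMLP θ₀ μ T W uW lW α)
include h

omit [IsProbabilityMeasure μ] in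
theorem measurable_sale {t : ℕ} (ht : t ∈ Finset.Icc 1 T) : Measurable (R.sale θ₀ t) := by
  refine Measurable.ite (measurableSet_le (h.measurable_p t ht) ?_) measurable_const
    measurable_const
  refine Measurable.add ?_ (h.measurable_η t ht)
  exact Finset.measurable_sum _ fun i _ =>
    ((measurable_pi_apply i).comp (h.measurable_x t ht)).const_mul (θ₀ i)

omit [IsProbabilityMeasure μ] in
theorem records_le {t : ℕ} (ht : t ≤ T) : R.records θ₀ t ≤ m0 := by
  refine iSup₂_le fun s hs => ?_
  have hs' : s ∈ Finset.Icc 1 T := Finset.Icc_subset_Icc_right ht hs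
  exact sup_le (sup_le (h.measurable_x s hs').comap_le (h.measurable_p s hs').comap_le)
    (h.measurable_sale hs').comap_le

omit [IsProbabilityMeasure μ] in
theorem hist_le {t : ℕ} (ht : t ∈ Finset.Icc 1 T) : R.hist θ₀ t ≤ m0 :=
  (R.hist_le_records θ₀ (Finset.mem_Icc.1 ht).1).trans (h.records_le (Finset.mem_Icc.1 ht).2)

theorem integrable_threshold {t : ℕ} (ht : t ∈ Finset.Icc 1 T) {q G : Ω → ℝ}
    (hq : Measurable[R.hist θ₀ t] q) (hG : Measurable[R.hist θ₀ t] G) {C : ℝ}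
    (hC : ∀ᵐ ω ∂μ, |G ω| ≤ C) : Integrable (fun ω => if q ω ≤ R.η t ω then G ω else 0) μ := by
  have hm := h.hist_le ht
  refine Integrable.of_bound (C := C) (Measurable.aestronglyMeasurable ?_) ?_
  · exact Measurable.ite (measurableSet_le (hq.mono hm le_rfl) (h.measurable_η t ht))
      (hG.mono hm le_rfl) measurable_const
  · filter_upwards [hC] with ω hω
    rw [Real.norm_eq_abs]
    split_ifs
    · exact hω
    · rw [abs_zero]; exact (abs_nonneg _).trans hω

/-- Conditional expectation of a hist-measurable gain paid when the noise reaches a threshold. -/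
theorem condExp_threshold {t : ℕ} (ht : t ∈ Finset.Icc 1 T) {q G : Ω → ℝ}
    (hq : Measurable[R.hist θ₀ t] q) (hG : Measurable[R.hist θ₀ t] G) {C : ℝ}
    (hC : ∀ᵐ ω ∂μ, |G ω| ≤ C) :
    μ[fun ω => if q ω ≤ R.η t ω then G ω else 0 | R.hist θ₀ t] =ᵐ[μ]
      fun ω => G ω * (R.law t ω).real (Ici (q ω)) := by
  have hm := h.hist_le ht
  have h1 := law_real_eq_condExp (μ := μ) hm (h.measurable_η t ht)
    (h.isProbabilityMeasure_law t ht) (h.measurable_law t ht) (h.law_eq t ht) hq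
  have e : (fun ω => if q ω ≤ R.η t ω then G ω else 0) =
      G * {ω | q ω ≤ R.η t ω}.indicator fun _ => (1 : ℝ) := by
    funext ω
    by_cases hω : q ω ≤ R.η t ω <;> simp [hω]
  have hi := h.integrable_threshold ht hq hG hC
  rw [e] at hi ⊢
  have h2 := condExp_mul_of_stronglyMeasurable_left (μ := μ) (m := R.hist θ₀ t)
    hG.stronglyMeasurable hi ((integrable_const (1 : ℝ)).indicator
      (measurableSet_le (hq.mono hm le_rfl) (h.measurable_η t ht)))
  filter_upwards [h1, h2] with ω e1 e2
  rw [e2, Pi.mul_apply, ← e1]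

omit [IsProbabilityMeasure μ] in
theorem ae_dot_mem {t : ℕ} (ht : t ∈ Finset.Icc 1 T) :
    ∀ᵐ ω ∂μ, ∀ θ : Fin d → ℝ, l1 θ ≤ W → θ ⬝ᵥ R.x t ω ∈ Icc (-W) W := by
  filter_upwards [h.abs_x_le t ht] with ω hω θ hθ
  exact abs_le.1 ((abs_dotProduct_le hω).trans hθ)

omit [IsProbabilityMeasure μ] in
/-- From the second round on the price is the optimal price for the estimated valuation. -/
theorem ae_price {t : ℕ} (ht : t ∈ Finset.Icc 2 T) : ∀ᵐ ω ∂μ, l1 (R.est (t - 1) ω) ≤ W ∧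
    R.p t ω = priceFn (R.law t ω) (R.est (t - 1) ω ⬝ᵥ R.x t ω) ∧ R.p t ω ∈ Icc 0 (2 * W) := by
  obtain ⟨h2, hT⟩ := Finset.mem_Icc.1 ht
  have e : t - 1 + 1 = t := by omega
  have hI : t - 1 ∈ Finset.Ico 1 T := Finset.mem_Ico.2 ⟨by omega, by omega⟩
  have ht1 : t ∈ Finset.Icc 1 T := Finset.mem_Icc.2 ⟨by omega, hT⟩
  have hp := h.price_eq (t - 1) hI
  rw [e] at hp
  filter_upwards [hp, h.isLasso_est (t - 1) hI, h.isNoiseLaw t ht1, h.ae_dot_mem ht1]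
    with ω h1 h3 h4 h5
  refine ⟨h3.1, h1, ?_⟩
  rw [h1]
  exact h4.priceFn_mem (h5 _ h3.1)

omit [IsProbabilityMeasure μ] in
theorem ae_abs_price_le {t : ℕ} (ht : t ∈ Finset.Icc 1 T) : ∀ᵐ ω ∂μ, |R.p t ω| ≤ 2 * W := by
  obtain ⟨h1, hT⟩ := Finset.mem_Icc.1 ht
  rcases h1.eq_or_lt with rfl | h1
  · exact h.abs_initial_price_le
  · filter_upwards [h.ae_price (Finset.mem_Icc.2 ⟨h1, hT⟩)] with ω hω
    rw [abs_of_nonneg hω.2.2.1]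
    exact hω.2.2.2

omit [IsProbabilityMeasure μ] in
theorem ae_sub_mem {t : ℕ} (ht : t ∈ Finset.Icc 1 T) :
    ∀ᵐ ω ∂μ, ∀ θ : Fin d → ℝ, l1 θ ≤ W →
      R.p t ω - θ ⬝ᵥ R.x t ω ∈ Icc (-(3 * W)) (3 * W) := by
  filter_upwards [h.ae_abs_price_le ht, h.ae_dot_mem ht] with ω h1 h2 θ hθ
  have h3 := abs_le.1 h1
  have h4 := h2 θ hθ
  exact ⟨by linarith [h3.1, h4.2], by linarith [h3.2, h4.1]⟩

omit [IsProbabilityMeasure μ] in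
theorem law_real_Ici {t : ℕ} (ht : t ∈ Finset.Icc 1 T) {ω : Ω}
    (hN : IsNoiseLaw W uW lW (R.law t ω)) {z : ℝ} (hz : z ∈ Icc (-(3 * W)) (3 * W)) :
    (R.law t ω).real (Ici z) = 1 - cdf (R.law t ω) z := by
  have := h.isProbabilityMeasure_law t ht ω
  exact real_Ici_eq (hN.differentiable z hz).continuousAt

/-! ### The score -/

omit [IsProbabilityMeasure μ] in
theorem measurable_score {t : ℕ} (ht : t ∈ Finset.Icc 1 T) :
    Measurable[R.records θ₀ t] (R.score θ₀ t) := by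
  have h1 := (Finset.mem_Icc.1 ht).1
  have hle := R.hist_le_records θ₀ h1
  have hF := measurable_cdf_comp (h.isProbabilityMeasure_law t ht) (h.measurable_law t ht)
    (R.measurable_cutoff θ₀ t)
  have hD := measurable_upperDensity_comp (h.isProbabilityMeasure_law t ht)
    (h.measurable_law t ht) (R.measurable_cutoff θ₀ t)
  refine Measurable.ite (R.measurable_sale_records θ₀ h1 (measurableSet_singleton 1)) ?_ ?_
  · exact (hD.div (hF.const_sub 1)).mono hle le_rfl
  · exact (hD.div hF).neg.mono hle le_rfl

omit [IsProbabilityMeasure μ] in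
theorem ae_score_eq (hθ : l1 θ₀ ≤ W) {t : ℕ} (ht : t ∈ Finset.Icc 1 T) :
    ∀ᵐ ω ∂μ, R.score θ₀ t ω = if R.sale θ₀ t ω = 1 then
      hazard (R.law t ω) (R.cutoff θ₀ t ω) else -revHazard (R.law t ω) (R.cutoff θ₀ t ω) := by
  filter_upwards [h.isNoiseLaw t ht, h.ae_sub_mem ht] with ω hN hz
  have hz' : R.cutoff θ₀ t ω ∈ _ := hz θ₀ hθ
  rw [score, upperDensity_eq (hN.differentiable _ hz')]
  rfl

omit [IsProbabilityMeasure μ] in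
theorem ae_abs_score_le (hθ : l1 θ₀ ≤ W) {t : ℕ} (ht : t ∈ Finset.Icc 1 T) :
    ∀ᵐ ω ∂μ, |R.score θ₀ t ω| ≤ uW := by
  filter_upwards [h.ae_score_eq hθ ht, h.isNoiseLaw t ht, h.ae_sub_mem ht] with ω he hN hz
  have hz' := hz θ₀ hθ
  rw [he]
  split_ifs
  · exact (abs_of_nonneg (hN.hazard_nonneg hz')).trans_le (hN.hazard_le hz')
  · rw [abs_neg]
    exact (abs_of_nonneg (hN.revHazard_nonneg hz')).trans_le (hN.revHazard_le hz')

/-- Given the history, a sale has probability `1 - F` and score `f / (1 - F)`, a failure has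
probability `F` and score `-f / F`; the conditional mean is `f - f = 0`. -/
theorem integral_score_mul (hθ : l1 θ₀ ≤ W) {t : ℕ} (ht : t ∈ Finset.Icc 1 T) {Y : Ω → ℝ}
    (hY : Measurable[R.hist θ₀ t] Y) {C : ℝ} (hC : ∀ᵐ ω ∂μ, |Y ω| ≤ C) :
    ∫ ω, R.score θ₀ t ω * Y ω ∂μ = 0 := by
  have hm := h.hist_le ht
  have hF := measurable_cdf_comp (h.isProbabilityMeasure_law t ht) (h.measurable_law t ht)
    (R.measurable_cutoff θ₀ t)
  have hD := measurable_upperDensity_comp (h.isProbabilityMeasure_law t ht)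
    (h.measurable_law t ht) (R.measurable_cutoff θ₀ t)
  let A : Ω → ℝ := fun ω => upperDensity (R.law t ω) (R.cutoff θ₀ t ω) /
    (1 - cdf (R.law t ω) (R.cutoff θ₀ t ω))
  let B : Ω → ℝ := fun ω => upperDensity (R.law t ω) (R.cutoff θ₀ t ω) /
    cdf (R.law t ω) (R.cutoff θ₀ t ω)
  have hA : Measurable[R.hist θ₀ t] A := hD.div (hF.const_sub 1)
  have hB : Measurable[R.hist θ₀ t] B := hD.div hF
  have hAB : ∀ᵐ ω ∂μ, |A ω| ≤ uW ∧ |B ω| ≤ uW := by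
    filter_upwards [h.isNoiseLaw t ht, h.ae_sub_mem ht] with ω hN hz
    have hz' : R.cutoff θ₀ t ω ∈ _ := hz θ₀ hθ
    simp only [A, B]
    rw [upperDensity_eq (hN.differentiable _ hz')]
    exact ⟨(abs_of_nonneg (hN.hazard_nonneg hz')).trans_le (hN.hazard_le hz'),
      (abs_of_nonneg (hN.revHazard_nonneg hz')).trans_le (hN.revHazard_le hz')⟩
  have hG : Measurable[R.hist θ₀ t] fun ω => Y ω * (A ω + B ω) := hY.mul (hA.add hB)
  have hGC : ∀ᵐ ω ∂μ, |Y ω * (A ω + B ω)| ≤ C * (uW + uW) := by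
    filter_upwards [hC, hAB] with ω h1 h2
    rw [abs_mul]
    exact mul_le_mul h1 ((abs_add_le _ _).trans (add_le_add h2.1 h2.2)) (abs_nonneg _)
      ((abs_nonneg _).trans h1)
  have hq := R.measurable_cutoff θ₀ t
  have e : ∀ ω, R.score θ₀ t ω * Y ω =
      (if R.cutoff θ₀ t ω ≤ R.η t ω then Y ω * (A ω + B ω) else 0) - Y ω * B ω := by
    intro ω
    rw [score]
    simp only [R.sale_eq_one_iff θ₀]
    split_ifs <;> simp only [A, B] <;> ring
  have hi2 : Integrable (fun ω => Y ω * B ω) μ := by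
    refine Integrable.of_bound (C := C * uW)
      ((hY.mul hB).mono hm le_rfl).aestronglyMeasurable ?_
    filter_upwards [hC, hAB] with ω h1 h2
    rw [Real.norm_eq_abs, abs_mul]
    exact mul_le_mul h1 h2.2 (abs_nonneg _) ((abs_nonneg _).trans h1)
  simp_rw [e]
  rw [integral_sub (h.integrable_threshold ht hq hG hGC) hi2, ← integral_condExp hm,
    integral_congr_ae (h.condExp_threshold ht hq hG hGC), sub_eq_zero]
  refine integral_congr_ae ?_
  filter_upwards [h.isNoiseLaw t ht, h.ae_sub_mem ht] with ω hN hz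
  have hz' : R.cutoff θ₀ t ω ∈ _ := hz θ₀ hθ
  simp only [h.law_real_Ici ht hN hz', A, B]
  have h1 := (hN.cdf_pos _ hz').ne'
  have h2 := (hN.tail_pos hz').ne'
  field_simp
  ring

/-! ### Revenue losses -/

omit [IsProbabilityMeasure μ] in
theorem exists_measurable_oraclePrice (hW : 0 < W) (hl : 0 < lW) (hθ : l1 θ₀ ≤ W) {t : ℕ}
    (ht : t ∈ Finset.Icc 1 T) : ∃ p : Ω → ℝ, Measurable[R.hist θ₀ t] p ∧
      p =ᵐ[μ] R.oraclePrice θ₀ t :=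
  exists_measurable_priceFn hW hl (h.isProbabilityMeasure_law t ht) (h.measurable_law t ht)
    (h.isNoiseLaw t ht) (R.measurable_dot_hist θ₀ θ₀ t)
    ((h.ae_dot_mem ht).mono fun _ hω => hω θ₀ hθ)

omit [IsProbabilityMeasure μ] in
theorem ae_oraclePrice_mem (hθ : l1 θ₀ ≤ W) {t : ℕ} (ht : t ∈ Finset.Icc 1 T) :
    ∀ᵐ ω ∂μ, R.oraclePrice θ₀ t ω ∈ Icc 0 (2 * W) := by
  filter_upwards [h.isNoiseLaw t ht, h.ae_dot_mem ht] with ω hN hω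
  exact hN.priceFn_mem (hω θ₀ hθ)

/-- At a price known to the history, revenue is a gain paid when the noise reaches a known
threshold, so `condExp_threshold` applies. The oracle price enters through a measurable version. -/
theorem revenueLoss_spec (hW : 0 < W) (hl : 0 < lW) (hθ : l1 θ₀ ≤ W) {t : ℕ}
    (ht : t ∈ Finset.Icc 1 T) : Integrable (R.revenueLoss θ₀ t) μ ∧
      R.condLoss θ₀ μ t =ᵐ[μ] fun ω =>
        expRevenue (R.law t ω) (θ₀ ⬝ᵥ R.x t ω) (R.oraclePrice θ₀ t ω) -
        expRevenue (R.law t ω) (θ₀ ⬝ᵥ R.x t ω) (R.p t ω) := by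
  obtain ⟨p, hp, hpe⟩ := h.exists_measurable_oraclePrice hW hl hθ ht
  have hdot := R.measurable_dot_hist θ₀ θ₀ t
  have hpC : ∀ᵐ ω ∂μ, |p ω| ≤ 2 * W := by
    filter_upwards [hpe, h.ae_oraclePrice_mem hθ ht] with ω e hω
    rw [e, abs_of_nonneg hω.1]
    exact hω.2
  have hq := hp.sub hdot
  have e : R.revenueLoss θ₀ t =ᵐ[μ]
      (fun ω => if p ω - θ₀ ⬝ᵥ R.x t ω ≤ R.η t ω then p ω else 0) -
      (fun ω => if R.cutoff θ₀ t ω ≤ R.η t ω then R.p t ω else 0) := by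
    filter_upwards [hpe] with ω hω
    simp only [revenueLoss, revenue, Pi.sub_apply, hω, cutoff, sub_le_iff_le_add', valuation]
    congr
  have i1 := h.integrable_threshold ht hq hp hpC
  have i2 := h.integrable_threshold ht (R.measurable_cutoff θ₀ t) (R.measurable_p_hist θ₀ t)
    (h.ae_abs_price_le ht)
  refine ⟨(i1.sub i2).congr e.symm, ?_⟩
  have c := (condExp_congr_ae (m := R.hist θ₀ t) e).trans
    (condExp_sub i1 i2 (R.hist θ₀ t))
  filter_upwards [c, h.condExp_threshold ht hq hp hpC,
    h.condExp_threshold ht (R.measurable_cutoff θ₀ t) (R.measurable_p_hist θ₀ t)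
    (h.ae_abs_price_le ht), h.isNoiseLaw t ht, h.ae_sub_mem ht, hpe,
    h.ae_oraclePrice_mem hθ ht, h.ae_dot_mem ht] with ω c1 c2 c3 hN hz hω hm hd
  have hz1 : R.cutoff θ₀ t ω ∈ _ := hz θ₀ hθ
  have hz2 : p ω - θ₀ ⬝ᵥ R.x t ω ∈ Icc (-(3 * W)) (3 * W) := by
    rw [hω]
    have := hd θ₀ hθ
    exact ⟨by linarith [hm.1, this.2], by linarith [hm.2, this.1]⟩
  rw [condLoss, c1, Pi.sub_apply, c2, c3]
  simp only [Pi.sub_apply, h.law_real_Ici ht hN hz1, h.law_real_Ici ht hN hz2]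
  rw [hω]; rfl

omit [IsProbabilityMeasure μ] in
theorem measurable_sqError {t : ℕ} (ht : t ∈ Finset.Ico 1 T) :
    Measurable[R.records θ₀ t] fun ω => sqL2 (R.est t ω - θ₀) := by
  have := h.measurable_est t ht
  exact Finset.measurable_sum _ fun i _ =>
    (((measurable_pi_apply i).comp this).sub_const (θ₀ i)).pow_const 2

omit [IsProbabilityMeasure μ] in
theorem ae_l1_error_le (hθ : l1 θ₀ ≤ W) {t : ℕ} (ht : t ∈ Finset.Ico 1 T) :
    ∀ᵐ ω ∂μ, l1 (R.est t ω - θ₀) ≤ 2 * W := by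
  filter_upwards [h.isLasso_est t ht] with ω hω
  linarith [l1_sub_le (R.est t ω) θ₀, hω.1]

theorem integrable_sqError (hθ : l1 θ₀ ≤ W) {t : ℕ} (ht : t ∈ Finset.Ico 1 T) :
    Integrable (fun ω => sqL2 (R.est t ω - θ₀)) μ := by
  refine Integrable.of_bound (C := (2 * W) ^ 2) ((h.measurable_sqError ht).mono
    (h.records_le (Finset.mem_Ico.1 ht).2.le) le_rfl).aestronglyMeasurable ?_
  filter_upwards [h.ae_l1_error_le hθ ht] with ω hω
  rw [Real.norm_eq_abs, abs_of_nonneg (sqL2_nonneg _)]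
  exact (sqL2_le_l1_sq _).trans (pow_le_pow_left₀ (l1_nonneg _) hω 2)

/-- The estimator that sets the price is a function of the earlier records, so conditioning leaves
its error unchanged. -/
theorem condSqError_eq (hθ : l1 θ₀ ≤ W) {t : ℕ} (ht : t ∈ Finset.Icc 2 T) :
    R.condSqError θ₀ μ t = fun ω => sqL2 (R.est (t - 1) ω - θ₀) := by
  obtain ⟨h2, hT⟩ := Finset.mem_Icc.1 ht
  have hI : t - 1 ∈ Finset.Ico 1 T := Finset.mem_Ico.2 ⟨by omega, by omega⟩
  exact condExp_of_stronglyMeasurable (h.hist_le (Finset.mem_Icc.2 ⟨by omega, hT⟩))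
    ((h.measurable_sqError hI).mono (R.records_le_hist θ₀ (by omega))
      le_rfl).stronglyMeasurable (h.integrable_sqError hθ hI)

/-- The conditional revenue loss is at most quadratic in the estimation error. -/
theorem condLoss_le (hW : 0 < W) (hl : 0 < lW) (hθ : l1 θ₀ ≤ W) {t : ℕ}
    (ht : t ∈ Finset.Icc 2 T) : ∀ᵐ ω ∂μ, R.condLoss θ₀ μ t ω ≤
      (2 * uW + 2 * W * uW ^ 2) * d * sqL2 (R.est (t - 1) ω - θ₀) := by
  obtain ⟨h2, hT⟩ := Finset.mem_Icc.1 ht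
  have ht1 : t ∈ Finset.Icc 1 T := Finset.mem_Icc.2 ⟨by omega, hT⟩
  filter_upwards [(h.revenueLoss_spec hW hl hθ ht1).2, h.isNoiseLaw t ht1, h.ae_dot_mem ht1,
    h.ae_price ht, h.abs_x_le t ht1] with ω e hN hd hp hx
  have hu := hN.steepness_pos hW hl
  have hv := hd θ₀ hθ
  rw [e]
  refine (hN.expRevenue_sub_le hW hl hv hp.2.2).trans ?_
  rw [mul_assoc _ (d : ℝ)]
  refine mul_le_mul_of_nonneg_left ?_ (by positivity)
  refine le_trans ?_ (l1_sq_le _)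
  rw [hp.2.1, ← sq_abs]
  refine pow_le_pow_left₀ (abs_nonneg _) ?_ 2
  refine (hN.abs_priceFn_sub_le hW hl hv (hd _ hp.1)).trans ?_
  rw [abs_sub_comm, ← sub_dotProduct]
  exact abs_dotProduct_le hx

omit [IsProbabilityMeasure μ] in
theorem ae_abs_revenueLoss_le (hθ : l1 θ₀ ≤ W) {t : ℕ} (ht : t ∈ Finset.Icc 1 T) :
    ∀ᵐ ω ∂μ, |R.revenueLoss θ₀ t ω| ≤ 4 * W := by
  filter_upwards [h.ae_oraclePrice_mem hθ ht, h.ae_abs_price_le ht] with ω h1 h2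
  have h0 : 0 ≤ 2 * W := (abs_nonneg _).trans h2
  have k : ∀ q, |q| ≤ 2 * W → |R.revenue θ₀ t ω q| ≤ 2 * W := fun q hq => by
    rw [revenue]
    split_ifs
    · exact hq
    · rwa [abs_zero]
  have k1 := k (R.oraclePrice θ₀ t ω) (by rw [abs_of_nonneg h1.1]; exact h1.2)
  have k2 := k _ h2
  rw [revenueLoss]
  exact (abs_sub _ _).trans (by linarith)

end IsOORMLP
end Run

/-! ### Exponential supermartingale of the scores -/

/-- The exponential lies below its chord on `[-u, u]`, and the Gaussian factor dominates `cosh`. The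
bound is affine in `ξ`, so averaging it needs only that the scores have conditional mean zero. -/
theorem exp_mul_sub_le {u ξ : ℝ} (hu : 0 < u) (hξ : |ξ| ≤ u) (a : ℝ) :
    Real.exp (ξ * a - u ^ 2 / 2 * a ^ 2) ≤
      1 + ξ * (Real.exp (-(u ^ 2 / 2 * a ^ 2)) * Real.sinh (u * a) / u) := by
  have h1 : Real.exp (ξ * a) ≤ Real.cosh (u * a) + ξ / u * Real.sinh (u * a) := by
    have h : |ξ / u| ≤ 1 := by
      rw [abs_div, abs_of_pos hu]
      exact (div_le_one hu).2 hξ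
    have := Real.exp_mul_le_cosh_add_mul_sinh h (u * a)
    rwa [show ξ / u * (u * a) = ξ * a by field_simp] at this
  have h2 : Real.cosh (u * a) ≤ Real.exp (u ^ 2 / 2 * a ^ 2) := by
    refine (Real.cosh_le_exp_half_sq _).trans (le_of_eq ?_)
    congr 1; ring
  rw [sub_eq_add_neg, Real.exp_add]
  calc Real.exp (ξ * a) * Real.exp (-(u ^ 2 / 2 * a ^ 2))
      ≤ (Real.exp (u ^ 2 / 2 * a ^ 2) + ξ / u * Real.sinh (u * a)) *
        Real.exp (-(u ^ 2 / 2 * a ^ 2)) :=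
        mul_le_mul_of_nonneg_right (by linarith) (Real.exp_pos _).le
    _ = _ := by
        rw [add_mul, ← Real.exp_add, add_neg_cancel, Real.exp_zero]
        ring

theorem abs_sinh_le_exp (x : ℝ) : |Real.sinh x| ≤ Real.exp |x| := by
  rw [Real.abs_sinh, Real.sinh_eq]
  have := Real.exp_pos |x|
  have := Real.exp_pos (-|x|)
  linarith

/-- The sum of the squares of `⟨v, x_s⟩`, `1 ≤ s ≤ t`. -/
def gram {d : ℕ} (x : ℕ → Fin d → ℝ) (t : ℕ) (v : Fin d → ℝ) : ℝ :=
  ∑ s ∈ Finset.Icc 1 t, (v ⬝ᵥ x s) ^ 2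

namespace Run

variable {d : ℕ} {Ω : Type*} (R : Run d Ω) (θ₀ : Fin d → ℝ)

/-- The sum of the scores of the first `t` rounds. -/
def scoreSum (t : ℕ) (ω : Ω) : Fin d → ℝ :=
  ∑ s ∈ Finset.Icc 1 t, R.score θ₀ s ω • R.x s ω

theorem dotProduct_scoreSum (t : ℕ) (ω : Ω) (v : Fin d → ℝ) :
    v ⬝ᵥ R.scoreSum θ₀ t ω = ∑ s ∈ Finset.Icc 1 t, R.score θ₀ s ω * v ⬝ᵥ R.x s ω := by
  rw [scoreSum, dotProduct_sum]
  simp only [dotProduct_smul, smul_eq_mul]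

/-- The exponential supermartingale of the scores in direction `v`. -/
def expScore (uW : ℝ) (v : Fin d → ℝ) (t : ℕ) (ω : Ω) : ℝ :=
  Real.exp (v ⬝ᵥ R.scoreSum θ₀ t ω - uW ^ 2 / 2 * gram (fun s => R.x s ω) t v)

theorem expScore_pos (uW : ℝ) (v : Fin d → ℝ) (t : ℕ) (ω : Ω) : 0 < R.expScore θ₀ uW v t ω :=
  Real.exp_pos _

theorem expScore_zero (uW : ℝ) (v : Fin d → ℝ) (ω : Ω) : R.expScore θ₀ uW v 0 ω = 1 := by
  simp [expScore, scoreSum, gram]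

theorem expScore_succ (uW : ℝ) (v : Fin d → ℝ) (t : ℕ) (ω : Ω) :
    R.expScore θ₀ uW v (t + 1) ω = R.expScore θ₀ uW v t ω *
      Real.exp (R.score θ₀ (t + 1) ω * v ⬝ᵥ R.x (t + 1) ω -
        uW ^ 2 / 2 * (v ⬝ᵥ R.x (t + 1) ω) ^ 2) := by
  rw [expScore, expScore, ← Real.exp_add, dotProduct_scoreSum, dotProduct_scoreSum, gram, gram,
    Finset.sum_Icc_succ_top (by omega), Finset.sum_Icc_succ_top (by omega)]
  congr 1; ring

namespace IsOORMLP

variable {R θ₀} [m0 : MeasurableSpace Ω] {μ : Measure Ω} [IsProbabilityMeasure μ] {T : ℕ}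
  {W uW lW α : ℝ} (h : R.IsOORMLP θ₀ μ T W uW lW α)
include h

omit [IsProbabilityMeasure μ] in
theorem measurable_expScore (v : Fin d → ℝ) {t : ℕ} (ht : t ≤ T) :
    Measurable[R.records θ₀ t] (R.expScore θ₀ uW v t) := by
  induction t with
  | zero =>
    have : R.expScore θ₀ uW v 0 = fun _ => 1 := funext (R.expScore_zero θ₀ uW v)
    rw [this]
    exact measurable_const
  | succ t ih =>
    have : R.expScore θ₀ uW v (t + 1) = _ := funext (R.expScore_succ θ₀ uW v t)
    rw [this]
    have h1 := (ih (by omega)).mono (R.records_mono θ₀ t.le_succ) le_rfl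
    have h2 := h.measurable_score (t := t + 1) (Finset.mem_Icc.2 ⟨by omega, ht⟩)
    have h3 := (R.measurable_dot_hist θ₀ v (t + 1)).mono
      (R.hist_le_records θ₀ (by omega)) le_rfl
    exact h1.mul (((h2.mul h3).sub ((h3.pow_const 2).const_mul _)).exp)

omit [IsProbabilityMeasure μ] in
theorem ae_expScore_le (hθ : l1 θ₀ ≤ W) (v : Fin d → ℝ) {t : ℕ} (ht : t ≤ T) :
    ∀ᵐ ω ∂μ, R.expScore θ₀ uW v t ω ≤ Real.exp (uW * l1 v) ^ t := by
  induction t with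
  | zero => exact Eventually.of_forall fun ω => by rw [expScore_zero, pow_zero]
  | succ t ih =>
    have ht' : t + 1 ∈ Finset.Icc 1 T := Finset.mem_Icc.2 ⟨by omega, ht⟩
    filter_upwards [ih (by omega), h.ae_abs_score_le hθ ht', h.abs_x_le _ ht'] with ω h1 h2 h3
    rw [expScore_succ, pow_succ]
    refine mul_le_mul h1 (Real.exp_le_exp.2 ?_) (Real.exp_pos _).le
      (pow_nonneg (Real.exp_pos _).le _)
    have h4 := abs_dotProduct_le (v := v) h3
    have h5 : R.score θ₀ (t + 1) ω * v ⬝ᵥ R.x (t + 1) ω ≤ uW * l1 v := by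
      refine (le_abs_self _).trans ?_
      rw [abs_mul]
      exact mul_le_mul h2 h4 (abs_nonneg _) ((abs_nonneg _).trans h2)
    have : 0 ≤ uW ^ 2 / 2 * (v ⬝ᵥ R.x (t + 1) ω) ^ 2 := by positivity
    linarith

theorem integrable_expScore (hθ : l1 θ₀ ≤ W) (v : Fin d → ℝ) {t : ℕ} (ht : t ≤ T) :
    Integrable (R.expScore θ₀ uW v t) μ := by
  refine Integrable.of_bound (C := Real.exp (uW * l1 v) ^ t)
    ((h.measurable_expScore v ht).mono (h.records_le ht) le_rfl).aestronglyMeasurable ?_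
  filter_upwards [h.ae_expScore_le hθ v ht] with ω hω
  rwa [Real.norm_eq_abs, abs_of_pos (R.expScore_pos θ₀ uW v t ω)]

/-- The exponentials of the compensated scores have mean at most one. -/
theorem integral_expScore_le (hu : 0 < uW) (hθ : l1 θ₀ ≤ W) (v : Fin d → ℝ) {t : ℕ}
    (ht : t ≤ T) : ∫ ω, R.expScore θ₀ uW v t ω ∂μ ≤ 1 := by
  induction t with
  | zero => simp [expScore_zero]
  | succ t ih =>
    have ht' : t + 1 ∈ Finset.Icc 1 T := Finset.mem_Icc.2 ⟨by omega, ht⟩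
    have hm := h.hist_le ht'
    let b : Ω → ℝ := fun ω => v ⬝ᵥ R.x (t + 1) ω
    -- The factor of the new score in the affine bound, times the exponential of the earlier rounds;
    -- it is known to the history.
    let Y : Ω → ℝ := fun ω => R.expScore θ₀ uW v t ω *
      (Real.exp (-(uW ^ 2 / 2 * b ω ^ 2)) * Real.sinh (uW * b ω) / uW)
    have hb : Measurable[R.hist θ₀ (t + 1)] b := R.measurable_dot_hist θ₀ v (t + 1)
    have hY : Measurable[R.hist θ₀ (t + 1)] Y := by
      have h1 := (h.measurable_expScore v (t := t) (by omega)).mono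
        (R.records_le_hist θ₀ t.lt_succ_self) le_rfl
      exact h1.mul ((((hb.pow_const 2).const_mul _).neg.exp.mul
        (Real.measurable_sinh.comp (hb.const_mul uW))).div_const uW)
    have hYC : ∀ᵐ ω ∂μ, |Y ω| ≤
        Real.exp (uW * l1 v) ^ t * (1 * Real.exp (uW * l1 v) / uW) := by
      filter_upwards [h.ae_expScore_le hθ v (t := t) (by omega), h.abs_x_le _ ht'] with ω h1 h2
      rw [abs_mul, abs_of_pos (R.expScore_pos θ₀ uW v t ω)]
      refine mul_le_mul h1 ?_ (abs_nonneg _) (by positivity)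
      rw [abs_div, abs_mul, abs_of_pos hu, abs_of_pos (Real.exp_pos _)]
      refine div_le_div_of_nonneg_right (mul_le_mul ?_ ?_ (abs_nonneg _) zero_le_one) hu.le
      · rw [Real.exp_le_one_iff, neg_nonpos]; positivity
      · refine (abs_sinh_le_exp _).trans (Real.exp_le_exp.2 ?_)
        rw [abs_mul, abs_of_pos hu]
        exact mul_le_mul_of_nonneg_left (abs_dotProduct_le h2) hu.le
    have hint : Integrable (fun ω => R.score θ₀ (t + 1) ω * Y ω) μ := by
      refine Integrable.of_bound
        (C := uW * (Real.exp (uW * l1 v) ^ t * (1 * Real.exp (uW * l1 v) / uW)))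
        (((h.measurable_score ht').mono (h.records_le ht) le_rfl).mul
          (hY.mono hm le_rfl)).aestronglyMeasurable ?_
      filter_upwards [hYC, h.ae_abs_score_le hθ ht'] with ω h1 h2
      rw [Real.norm_eq_abs, abs_mul]
      exact mul_le_mul h2 h1 (abs_nonneg _) hu.le
    have hE := h.integrable_expScore hθ v (t := t) (by omega)
    calc ∫ ω, R.expScore θ₀ uW v (t + 1) ω ∂μ
        ≤ ∫ ω, (R.expScore θ₀ uW v t ω + R.score θ₀ (t + 1) ω * Y ω) ∂μ := by
          refine integral_mono_ae (h.integrable_expScore hθ v ht) (hE.add hint) ?_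
          filter_upwards [h.ae_abs_score_le hθ ht'] with ω hω
          rw [expScore_succ]
          refine (mul_le_mul_of_nonneg_left (exp_mul_sub_le hu hω _)
            (R.expScore_pos θ₀ uW v t ω).le).trans (le_of_eq ?_)
          simp only [Y, b]; ring
      _ = ∫ ω, R.expScore θ₀ uW v t ω ∂μ := by
          rw [integral_add hE hint, h.integral_score_mul hθ ht' hY hYC, add_zero]
      _ ≤ 1 := ih (by omega)

end IsOORMLP
end Run

/-! ### Deterministic error bounds -/

section Deterministic

variable {d : ℕ}

theorem l1_split (J : Finset (Fin d)) (v : Fin d → ℝ) :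
    l1 v = ∑ i ∈ J, |v i| + ∑ i ∈ Jᶜ, |v i| := (Finset.sum_add_sum_compl J _).symm

theorem abs_dotProduct_le_mul {v S : Fin d → ℝ} {B : ℝ} (hB : ∀ i, |S i| ≤ B) :
    |v ⬝ᵥ S| ≤ l1 v * B := by
  rw [l1, Finset.sum_mul]
  refine (Finset.abs_sum_le_sum_abs _ _).trans (Finset.sum_le_sum fun i _ => ?_)
  rw [abs_mul]
  exact mul_le_mul_of_nonneg_left (hB i) (abs_nonneg _)

theorem abs_le_sqrt_mul {t : ℝ} (ht : 0 < t) (S : Fin d → ℝ) (i : Fin d) :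
    |S i| ≤ √t * √(∑ j, S j ^ 2 / t) := by
  rw [← Real.sqrt_mul ht.le]
  refine Real.abs_le_sqrt ?_
  rw [Finset.mul_sum]
  have : S i ^ 2 = t * (S i ^ 2 / t) := by field_simp
  rw [this]
  exact Finset.single_le_sum (f := fun j => t * (S j ^ 2 / t))
    (fun j _ => by positivity) (Finset.mem_univ i)

/-- Error bound in the cone on which the restricted eigenvalue is bounded below. -/
theorem sq_le_of_mem_cone {l φ Λ₁ Λ t Q : ℝ} (hl : 0 < l) (hφ : 0 < φ) (hΛ : Λ ≤ Λ₁)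
    (hΛ0 : 0 ≤ Λ) (ht : 0 < t) (hd : 0 < d) {v S : Fin d → ℝ} {J : Finset (Fin d)}
    (hcone : ∑ i ∈ Jᶜ, |v i| ≤ 3 * ∑ i ∈ J, |v i|)
    (hRE : t * φ ^ 2 * ∑ i ∈ J, v i ^ 2 ≤ Q)
    (hbasic : l / 2 * Q + √t * Λ * (∑ i ∈ Jᶜ, |v i| - ∑ i ∈ J, |v i|) ≤ v ⬝ᵥ S) :
    t * l1 v ^ 2 ≤ 16 * (2 * d / (l * φ ^ 2)) ^ 2 * (2 * Λ₁ ^ 2 + 32 * ∑ j, S j ^ 2 / t) := by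
  have hN : 0 ≤ ∑ j, S j ^ 2 / t := Finset.sum_nonneg fun j _ => by positivity
  set σ := √(∑ j, S j ^ 2 / t) with hσ
  have hσ2 : σ ^ 2 = ∑ j, S j ^ 2 / t := Real.sq_sqrt hN
  have hσ0 : 0 ≤ σ := Real.sqrt_nonneg _
  have hst : √t ^ 2 = t := Real.sq_sqrt ht.le
  have hst0 : 0 < √t := Real.sqrt_pos.2 ht
  set A := ∑ i ∈ J, |v i|
  set B := ∑ i ∈ Jᶜ, |v i|
  have hA : 0 ≤ A := Finset.sum_nonneg fun _ _ => abs_nonneg _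
  have hB : 0 ≤ B := Finset.sum_nonneg fun _ _ => abs_nonneg _
  have hv : l1 v = A + B := l1_split J v
  have hd' : (0 : ℝ) < d := by exact_mod_cast hd
  -- Replacing the size of `J` by `d` keeps `s₀` out of the constant.
  have h1 : A ^ 2 ≤ d * ∑ i ∈ J, v i ^ 2 := by
    have h2 := sq_sum_le_card_mul_sum_sq (s := J) (f := fun i => |v i|)
    simp only [sq_abs] at h2
    refine h2.trans (mul_le_mul_of_nonneg_right ?_ (Finset.sum_nonneg fun _ _ => sq_nonneg _))
    exact_mod_cast (Finset.card_le_univ J).trans_eq (Fintype.card_fin d)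
  have h2 : v ⬝ᵥ S ≤ (A + B) * (√t * σ) := by
    rw [← hv]
    exact (le_abs_self _).trans (abs_dotProduct_le_mul (abs_le_sqrt_mul ht S))
  -- The curvature is at least quadratic in `y`, while penalty and score terms are linear in `y`;
  -- hence `y` is bounded.
  set y := √t * A with hy
  have hy0 : 0 ≤ y := by positivity
  have h3 : l / 2 * Q ≤ y * (Λ₁ + 4 * σ) := by
    have e1 : √t * Λ * (A - B) ≤ y * Λ₁ := by
      calc √t * Λ * (A - B) ≤ √t * Λ * A :=
            mul_le_mul_of_nonneg_left (by linarith) (by positivity)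
        _ = y * Λ := by rw [hy]; ring
        _ ≤ y * Λ₁ := mul_le_mul_of_nonneg_left hΛ hy0
    have e2 : (A + B) * (√t * σ) ≤ y * (4 * σ) := by
      calc (A + B) * (√t * σ) ≤ (4 * A) * (√t * σ) :=
            mul_le_mul_of_nonneg_right (by linarith) (by positivity)
        _ = y * (4 * σ) := by rw [hy]; ring
    linarith [e1, e2, hbasic, h2]
  have h4 : l * φ ^ 2 / (2 * d) * y ^ 2 ≤ y * (Λ₁ + 4 * σ) := by
    refine le_trans ?_ h3
    have : φ ^ 2 * y ^ 2 / d ≤ Q := by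
      refine le_trans ?_ hRE
      rw [div_le_iff₀ hd', hy, mul_pow, hst]
      have := mul_le_mul_of_nonneg_left h1 (by positivity : 0 ≤ t * φ ^ 2)
      linarith
    calc l * φ ^ 2 / (2 * d) * y ^ 2 = l / 2 * (φ ^ 2 * y ^ 2 / d) := by field_simp
      _ ≤ l / 2 * Q := mul_le_mul_of_nonneg_left this (by positivity)
  have hΛσ : 0 ≤ Λ₁ + 4 * σ := by linarith
  have h5 : y ≤ 2 * d / (l * φ ^ 2) * (Λ₁ + 4 * σ) := by
    rcases hy0.eq_or_lt with h0 | h0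
    · rw [← h0]; positivity
    · have : l * φ ^ 2 / (2 * d) * y ≤ Λ₁ + 4 * σ := by
        refine le_of_mul_le_mul_left ?_ h0
        linarith
      calc y = 2 * d / (l * φ ^ 2) * (l * φ ^ 2 / (2 * d) * y) := by field_simp
        _ ≤ _ := mul_le_mul_of_nonneg_left this (by positivity)
  have h6 : t * l1 v ^ 2 ≤ 16 * y ^ 2 := by
    rw [hv, hy, mul_pow, hst]
    have : (A + B) ^ 2 ≤ (4 * A) ^ 2 := pow_le_pow_left₀ (by positivity) (by linarith) 2
    nlinarith
  have h7 := pow_le_pow_left₀ hy0 h5 2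
  rw [mul_pow] at h7
  have h8 : (Λ₁ + 4 * σ) ^ 2 ≤ 2 * Λ₁ ^ 2 + 32 * ∑ j, S j ^ 2 / t := by
    rw [← hσ2]
    nlinarith [sq_nonneg (Λ₁ - 4 * σ)]
  have h9 := mul_le_mul_of_nonneg_left h8 (sq_nonneg (2 * d / (l * φ ^ 2)))
  linarith

/-! ### Errors outside the cone -/

theorem gram_smul (x : ℕ → Fin d → ℝ) (t : ℕ) (c : ℝ) (v : Fin d → ℝ) :
    gram x t (c • v) = c ^ 2 * gram x t v := by
  simp only [gram, smul_dotProduct, smul_eq_mul, mul_pow, Finset.mul_sum]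

/-- Error bound away from the cone: either the scores are large or a compensated score is large
in the direction of a lattice point close to the error. -/
theorem sq_le_of_notMem_cone {l u Λ₀ β c W : ℝ} {t n : ℕ} (hl : 0 < l) (hu : 0 < u)
    (hΛ : 0 < Λ₀) (hβ : β = l / (2 * u ^ 2)) (hc : c = β * Λ₀ / 4) (ht : 1 ≤ t)
    {x : ℕ → Fin d → ℝ} (hx : ∀ s ∈ Finset.Icc 1 t, ∀ i, |x s i| ≤ 1) {v S : Fin d → ℝ}
    (hvW : l1 v ≤ 2 * W) (hn : 2 * W * √t + 1 ≤ n)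
    (hbasic : l / 2 * gram x t v + √t * Λ₀ * l1 v / 2 ≤ v ⬝ᵥ S) :
    t * l1 v ^ 2 ≤ 32 / Λ₀ ^ 2 * (d ^ 2 * ∑ j, S j ^ 2 / t + l ^ 2 * d ^ 4 / 4) ∨
    t * l1 v ^ 2 ≤ 8 / c ^ 2 * Real.exp (c * d / 2) *
      ∑ k ∈ Fintype.piFinset fun _ : Fin d => Finset.Icc (-(n : ℤ)) n,
        Real.exp (-(c / 2) * l1 fun i => (k i : ℝ)) *
          Real.exp (((β / √t) • fun i => (k i : ℝ)) ⬝ᵥ S -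
            u ^ 2 / 2 * gram x t ((β / √t) • fun i => (k i : ℝ))) := by
  have ht0 : (0 : ℝ) < t := by exact_mod_cast ht
  have hN : 0 ≤ ∑ j, S j ^ 2 / (t : ℝ) := Finset.sum_nonneg fun j _ => by positivity
  set σ := √(∑ j, S j ^ 2 / (t : ℝ)) with hσ
  have hσ2 : σ ^ 2 = ∑ j, S j ^ 2 / (t : ℝ) := Real.sq_sqrt hN
  have hσ0 : 0 ≤ σ := Real.sqrt_nonneg _
  have hst : √(t : ℝ) ^ 2 = t := Real.sq_sqrt ht0.le
  have hst0 : 0 < √(t : ℝ) := Real.sqrt_pos.2 ht0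
  have hst1 : 1 ≤ √(t : ℝ) := by
    rw [Real.one_le_sqrt]; exact_mod_cast ht
  have hβ0 : 0 < β := by rw [hβ]; positivity
  have hc0 : 0 < c := by rw [hc]; positivity
  set a := √(t : ℝ) * l1 v with ha
  have ha0 : 0 ≤ a := mul_nonneg hst0.le (l1_nonneg v)
  have ha2 : (t : ℝ) * l1 v ^ 2 = a ^ 2 := by rw [ha, mul_pow, hst]
  rw [ha2]
  -- `d * σ` and `l / 2 * d ^ 2` are the costs, in the linear and the quadratic term, of rounding
  -- `√t v` to an integer vector. Half of the penalty gain `Λ₀ / 2 * a` is reserved for them.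
  rcases le_or_gt (Λ₀ / 4 * a) (d * σ + l / 2 * d ^ 2) with hsmall | hlarge
  · left
    have h1 := pow_le_pow_left₀ (by positivity) hsmall 2
    have h2 : (d * σ + l / 2 * d ^ 2) ^ 2 ≤ 2 * (d ^ 2 * σ ^ 2 + l ^ 2 * d ^ 4 / 4) := by
      nlinarith [sq_nonneg (d * σ - l / 2 * d ^ 2)]
    rw [← hσ2]
    calc a ^ 2 = 16 / Λ₀ ^ 2 * (Λ₀ / 4 * a) ^ 2 := by field_simp; norm_num
      _ ≤ 16 / Λ₀ ^ 2 * (2 * (d ^ 2 * σ ^ 2 + l ^ 2 * d ^ 4 / 4)) :=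
          mul_le_mul_of_nonneg_left (h1.trans h2) (by positivity)
      _ = _ := by ring
  · right
    let k : Fin d → ℤ := fun i => ⌊√(t : ℝ) * v i⌋
    let w : Fin d → ℝ := fun i => (k i : ℝ)
    let e : Fin d → ℝ := fun i => √(t : ℝ) * v i - w i
    have he : ∀ i, |e i| ≤ 1 := fun i => by
      have h1 := Int.floor_le (√(t : ℝ) * v i)
      have h2 := Int.lt_floor_add_one (√(t : ℝ) * v i)
      rw [abs_le]
      constructor <;> simp only [e, w, k] <;> linarith
    have hel : l1 e ≤ d := by
      refine (Finset.sum_le_sum fun i _ => he i).trans ?_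
      simp
    have hew : √(t : ℝ) • v = w + e := by
      funext i; simp [e]
    have hwe : w = √(t : ℝ) • v - e := by rw [hew]; simp
    have hwl : l1 w ≤ a + d := by
      rw [hwe]
      refine (l1_sub_le _ _).trans (add_le_add (le_of_eq ?_) hel)
      simp only [l1, Pi.smul_apply, smul_eq_mul, abs_mul, abs_of_pos hst0, ← Finset.mul_sum, ha]
    have hkn : k ∈ Fintype.piFinset fun _ : Fin d => Finset.Icc (-(n : ℤ)) n := by
      rw [Fintype.mem_piFinset]
      intro i
      have h1 : |w i| ≤ n := by
        have h2 : |w i| ≤ |√(t : ℝ) * v i| + |e i| := by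
          have : w i = √(t : ℝ) * v i - e i := by simp [e]
          rw [this]
          exact abs_sub _ _
        have h3 : |v i| ≤ l1 v :=
          Finset.single_le_sum (f := fun i => |v i|) (fun _ _ => abs_nonneg _)
            (Finset.mem_univ i)
        rw [abs_mul, abs_of_pos hst0] at h2
        have h4 := mul_le_mul_of_nonneg_left (h3.trans hvW) hst0.le
        linarith [he i]
      have h5 : |k i| ≤ (n : ℤ) := by
        have : |(k i : ℝ)| ≤ ((n : ℤ) : ℝ) := by simpa using h1
        exact_mod_cast this
      exact Finset.mem_Icc.2 (abs_le.1 h5)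
    have hlin : √(t : ℝ) * v ⬝ᵥ S ≤ w ⬝ᵥ S + d * (√(t : ℝ) * σ) := by
      have h1 : √(t : ℝ) * v ⬝ᵥ S = w ⬝ᵥ S + e ⬝ᵥ S := by
        rw [← add_dotProduct, ← hew, smul_dotProduct, smul_eq_mul]
      rw [h1]
      refine add_le_add le_rfl ((le_abs_self _).trans
        ((abs_dotProduct_le_mul (abs_le_sqrt_mul ht0 S)).trans ?_))
      exact mul_le_mul_of_nonneg_right hel (by positivity)
    have hquad : gram x t w ≤ 2 * (t * gram x t v) + 2 * (t * d ^ 2) := by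
      have h1 : ∀ s ∈ Finset.Icc 1 t, (w ⬝ᵥ x s) ^ 2 ≤
          2 * (t * (v ⬝ᵥ x s) ^ 2) + 2 * d ^ 2 := by
        intro s hs
        have h2 : w ⬝ᵥ x s = √(t : ℝ) * v ⬝ᵥ x s - e ⬝ᵥ x s := by
          rw [hwe, sub_dotProduct, smul_dotProduct, smul_eq_mul]
        have h3 : (e ⬝ᵥ x s) ^ 2 ≤ (d : ℝ) ^ 2 := by
          rw [← sq_abs]
          exact pow_le_pow_left₀ (abs_nonneg _) ((abs_dotProduct_le (hx s hs)).trans hel) 2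
        have h4 : (t : ℝ) * (v ⬝ᵥ x s) ^ 2 = (√(t : ℝ) * v ⬝ᵥ x s) ^ 2 := by
          rw [mul_pow, hst]
        rw [h2, h4]
        nlinarith [sq_nonneg (√(t : ℝ) * v ⬝ᵥ x s + e ⬝ᵥ x s)]
      refine (Finset.sum_le_sum h1).trans (le_of_eq ?_)
      rw [Finset.sum_add_distrib, ← Finset.mul_sum, ← Finset.mul_sum, Finset.sum_const,
        Nat.card_Icc, gram]
      simp only [add_tsub_cancel_right, nsmul_eq_mul]
      ring
    have hexp : c * a ≤ ((β / √(t : ℝ)) • w) ⬝ᵥ S -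
        u ^ 2 / 2 * gram x t ((β / √(t : ℝ)) • w) := by
      rw [gram_smul, smul_dotProduct, smul_eq_mul, div_pow, hst]
      have h1 : v ⬝ᵥ S ≤ w ⬝ᵥ S / √(t : ℝ) + d * σ := by
        rw [← mul_le_mul_iff_right₀ hst0]
        refine hlin.trans (le_of_eq ?_)
        field_simp
      have h2 : gram x t w / t ≤ 2 * gram x t v + 2 * d ^ 2 := by
        rw [div_le_iff₀ ht0]; linarith
      have h3 : √(t : ℝ) * Λ₀ * l1 v / 2 = Λ₀ / 2 * a := by rw [ha]; ring
      have h4 : Λ₀ / 4 * a ≤ w ⬝ᵥ S / √(t : ℝ) - l / 4 * (gram x t w / t) := by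
        rw [h3] at hbasic
        have := mul_le_mul_of_nonneg_left h2 (by positivity : 0 ≤ l / 4)
        linarith
      -- `β = l / (2u²)` turns the compensator into `β * l / 4` times the normalized quadratic form;
      -- after the factor two lost in `hquad` this uses up exactly the curvature `l / 2`.
      have h5 : β / √(t : ℝ) * w ⬝ᵥ S - u ^ 2 / 2 * (β ^ 2 / t * gram x t w) =
          β * (w ⬝ᵥ S / √(t : ℝ) - l / 4 * (gram x t w / t)) := by
        have : l = 2 * u ^ 2 * β := by rw [hβ]; field_simp
        rw [this]; ring
      rw [h5, hc]
      have := mul_le_mul_of_nonneg_left h4 hβ0.le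
      linarith
    have hsq : a ^ 2 ≤ 8 / c ^ 2 * Real.exp (c * a / 2) := by
      have h1 := Real.quadratic_le_exp_of_nonneg (by positivity : 0 ≤ c * a / 2)
      have h2 : (c * a / 2) ^ 2 / 2 ≤ Real.exp (c * a / 2) := by
        have : 0 ≤ c * a / 2 := by positivity
        linarith
      calc a ^ 2 = 8 / c ^ 2 * ((c * a / 2) ^ 2 / 2) := by field_simp; norm_num
        _ ≤ _ := mul_le_mul_of_nonneg_left h2 (by positivity)
    -- Of the exponent `c * a`, one half dominates `a ^ 2` and the other supplies the decaying
    -- weight that makes the lattice sum converge.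
    have hterm : Real.exp (c * a / 2) ≤ Real.exp (c * d / 2) *
        (Real.exp (-(c / 2) * l1 w) * Real.exp (((β / √(t : ℝ)) • w) ⬝ᵥ S -
          u ^ 2 / 2 * gram x t ((β / √(t : ℝ)) • w))) := by
      rw [← Real.exp_add, ← Real.exp_add, Real.exp_le_exp]
      have := mul_le_mul_of_nonneg_left hwl (by positivity : 0 ≤ c / 2)
      linarith
    refine hsq.trans ?_
    rw [mul_assoc]
    refine mul_le_mul_of_nonneg_left (hterm.trans (mul_le_mul_of_nonneg_left ?_
      (Real.exp_pos _).le)) (by positivity)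
    -- The lattice point depends on the outcome; the sum over the whole box does not refer to it, so
    -- its mean can be taken term by term.
    exact Finset.single_le_sum (f := fun k : Fin d → ℤ =>
        Real.exp (-(c / 2) * l1 fun i => (k i : ℝ)) *
          Real.exp (((β / √(t : ℝ)) • fun i => (k i : ℝ)) ⬝ᵥ S -
            u ^ 2 / 2 * gram x t ((β / √(t : ℝ)) • fun i => (k i : ℝ))))
      (fun _ _ => by positivity) hkn

/-! ### Scores in coordinate directions and lattice sums -/

theorem gram_single_le {x : ℕ → Fin d → ℝ} {t : ℕ} (hx : ∀ s ∈ Finset.Icc 1 t, ∀ i, |x s i| ≤ 1)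
    (i : Fin d) (c : ℝ) : gram x t (Pi.single i c) ≤ t * c ^ 2 := by
  have : ∀ s ∈ Finset.Icc 1 t, (Pi.single i c ⬝ᵥ x s) ^ 2 ≤ c ^ 2 := fun s hs => by
    rw [single_dotProduct, mul_pow, ← sq_abs (x s i)]
    exact mul_le_of_le_one_right (sq_nonneg _) (pow_le_one₀ (abs_nonneg _) (hx s hs i))
  refine (Finset.sum_le_sum this).trans (le_of_eq ?_)
  simp

/-- With `y = S i / √t` one has `y² ≤ 2 exp |y| ≤ 2 (exp y + exp (-y))`. In the directions `±1 / √t`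
the compensator is at most `u² / 2`, which goes into the constant. -/
theorem sq_div_le_exp {u : ℝ} {t : ℕ} (ht : 1 ≤ t) {x : ℕ → Fin d → ℝ}
    (hx : ∀ s ∈ Finset.Icc 1 t, ∀ i, |x s i| ≤ 1) (S : Fin d → ℝ) (i : Fin d) :
    S i ^ 2 / t ≤ 2 * Real.exp (u ^ 2 / 2) *
      (Real.exp (Pi.single i (1 / √t) ⬝ᵥ S - u ^ 2 / 2 * gram x t (Pi.single i (1 / √t))) +
      Real.exp (Pi.single i (-(1 / √t)) ⬝ᵥ S -
        u ^ 2 / 2 * gram x t (Pi.single i (-(1 / √t))))) := by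
  have ht0 : (0 : ℝ) < t := by exact_mod_cast ht
  have hst : √(t : ℝ) ^ 2 = t := Real.sq_sqrt ht0.le
  have hst0 : 0 < √(t : ℝ) := Real.sqrt_pos.2 ht0
  have hg : ∀ b : ℝ, b ^ 2 = 1 / t → Real.exp (b * S i) ≤ Real.exp (u ^ 2 / 2) *
      Real.exp (Pi.single i b ⬝ᵥ S - u ^ 2 / 2 * gram x t (Pi.single i b)) := by
    intro b hb
    rw [← Real.exp_add, Real.exp_le_exp, single_dotProduct]
    have h1 := gram_single_le hx i b
    rw [hb, mul_one_div_cancel ht0.ne'] at h1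
    have := mul_le_mul_of_nonneg_left h1 (by positivity : 0 ≤ u ^ 2 / 2)
    linarith
  have h1 := hg (1 / √(t : ℝ)) (by rw [div_pow, hst, one_pow])
  have h2 := hg (-(1 / √(t : ℝ))) (by rw [neg_sq, div_pow, hst, one_pow])
  set y := 1 / √(t : ℝ) * S i with hy
  have h3 : S i ^ 2 / t = |y| ^ 2 := by
    rw [sq_abs, hy, mul_pow, div_pow, hst]; ring
  have h4 := Real.quadratic_le_exp_of_nonneg (abs_nonneg y)
  have h5 : Real.exp |y| ≤ Real.exp y + Real.exp (-y) := by
    have p1 := Real.exp_pos y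
    have p2 := Real.exp_pos (-y)
    rcases abs_cases y with ⟨e, _⟩ | ⟨e, _⟩ <;> rw [e] <;> linarith
  rw [neg_mul] at h2
  rw [h3]
  have := abs_nonneg y
  linarith

theorem summable_exp_neg_abs {c : ℝ} (hc : 0 < c) :
    Summable fun k : ℤ => Real.exp (-c * |(k : ℝ)|) := by
  have h : Summable fun n : ℕ => Real.exp (n * -c) :=
    Real.summable_exp_nat_mul_iff.2 (neg_lt_zero.2 hc)
  refine Summable.of_nat_of_neg (h.congr fun n => ?_) (h.congr fun n => ?_) <;>
  · simp [mul_comm]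

/-- The weight is a product over coordinates, so the sum is at most the `d`-th power of a
one-dimensional series, whatever the size of the box. -/
theorem sum_box_exp_le {c : ℝ} (hc : 0 < c) (n : ℕ) :
    ∑ k ∈ Fintype.piFinset fun _ : Fin d => Finset.Icc (-(n : ℤ)) n,
      Real.exp (-c * l1 fun i => (k i : ℝ)) ≤ (∑' k : ℤ, Real.exp (-c * |(k : ℝ)|)) ^ d := by
  have h1 : ∀ k : Fin d → ℤ, Real.exp (-c * l1 fun i => (k i : ℝ)) =
      ∏ i, Real.exp (-c * |(k i : ℝ)|) := fun k => by
    rw [← Real.exp_sum, l1, Finset.mul_sum]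
  simp_rw [h1]
  rw [← Finset.prod_univ_sum (fun _ : Fin d => Finset.Icc (-(n : ℤ)) n)
    (fun _ k => Real.exp (-c * |(k : ℝ)|)), Finset.prod_const, Finset.card_univ, Fintype.card_fin]
  refine pow_le_pow_left₀ (Finset.sum_nonneg fun _ _ => (Real.exp_pos _).le) ?_ d
  exact (summable_exp_neg_abs hc).sum_le_tsum _ fun _ _ => (Real.exp_pos _).le

end Deterministic

namespace Run

variable {d : ℕ} {Ω : Type*} (R : Run d Ω) (θ₀ : Fin d → ℝ)

/-! ### The empirical covariance and the regularization parameter -/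

theorem dotProduct_empCov_mulVec (t : ℕ) (ω : Ω) (v : Fin d → ℝ) :
    v ⬝ᵥ (R.empCov t ω).mulVec v = (t : ℝ)⁻¹ * gram (fun s => R.x s ω) t v := by
  rw [empCov, Matrix.smul_mulVec, dotProduct_smul, smul_eq_mul, Matrix.sum_mulVec,
    dotProduct_sum, gram]
  congr 1
  refine Finset.sum_congr rfl fun s _ => ?_
  rw [Matrix.vecMulVec_mulVec]
  simp [dotProduct_comm, sq]

theorem empCov_apply_self (t : ℕ) (ω : Ω) (i : Fin d) :
    R.empCov t ω i i = (t : ℝ)⁻¹ * ∑ s ∈ Finset.Icc 1 t, R.x s ω i ^ 2 := by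
  rw [empCov, Matrix.smul_apply, smul_eq_mul, Matrix.sum_apply]
  simp only [Matrix.vecMulVec_apply, sq]

theorem iSup_empCov_le {t : ℕ} {ω : Ω} (ht : 1 ≤ t)
    (hx : ∀ s ∈ Finset.Icc 1 t, ∀ i, |R.x s ω i| ≤ 1) : ⨆ i, |R.empCov t ω i i| ≤ 1 := by
  refine Real.iSup_le (fun i => ?_) zero_le_one
  have ht0 : (0 : ℝ) < t := by exact_mod_cast ht
  rw [empCov_apply_self, abs_of_nonneg (by positivity), inv_mul_le_iff₀ ht0, mul_one]
  have : ∀ s ∈ Finset.Icc 1 t, R.x s ω i ^ 2 ≤ 1 := fun s hs => by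
    rw [← sq_abs]
    exact pow_le_one₀ (abs_nonneg _) (hx s hs i)
  refine (Finset.sum_le_sum this).trans (le_of_eq ?_)
  simp

/-- The unit vector `e_i` lies in the cone of `{i}`, so the condition bounds a diagonal entry. This
keeps the regularization away from zero. -/
theorem le_iSup_empCov {s₀ t : ℕ} {ω : Ω} {c : ℝ} (hs₀ : 1 ≤ s₀) (i : Fin d)
    (h : RestrictedEigenvalueGE s₀ (R.empCov t ω) c) : c ≤ ⨆ i, |R.empCov t ω i i| := by
  have h1 := h {i} (by simpa using hs₀) (Pi.single i 1) (by simp) (by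
    have : ∑ j ∈ ({i} : Finset (Fin d))ᶜ, |(Pi.single i 1 : Fin d → ℝ) j| = 0 :=
      Finset.sum_eq_zero fun j hj => by
        have : j ≠ i := by simpa using hj
        simp [this]
    rw [this]
    positivity)
  have h2 : c ≤ R.empCov t ω i i := by simpa using h1
  exact h2.trans ((le_abs_self _).trans
    (le_ciSup (f := fun i => |R.empCov t ω i i|) (finite_range _).bddAbove i))

/-- Division-free form of the condition, valid also when `v` vanishes on `J`. -/
theorem mul_sum_sq_le_gram {s₀ t : ℕ} {ω : Ω} {φ : ℝ} (ht : 1 ≤ t)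
    (h : RestrictedEigenvalueGE s₀ (R.empCov t ω) (φ ^ 2)) {J : Finset (Fin d)}
    (hJ : J.card ≤ s₀) {v : Fin d → ℝ}
    (hv : ∑ i ∈ Jᶜ, |v i| ≤ 3 * ∑ i ∈ J, |v i|) :
    t * φ ^ 2 * ∑ i ∈ J, v i ^ 2 ≤ gram (fun s => R.x s ω) t v := by
  have ht0 : (0 : ℝ) < t := by exact_mod_cast ht
  have hs : 0 ≤ ∑ i ∈ J, v i ^ 2 := Finset.sum_nonneg fun _ _ => sq_nonneg _
  rcases hs.eq_or_lt with h0 | h0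
  · rw [← h0, mul_zero]
    exact Finset.sum_nonneg fun _ _ => sq_nonneg _
  · have hv0 : v ≠ 0 := by
      rintro rfl
      simp at h0
    have h1 := h J hJ v hv0 hv
    rw [le_div_iff₀ h0, dotProduct_empCov_mulVec, ← div_eq_inv_mul, le_div_iff₀ ht0] at h1
    linarith

/-- Multiplied by `t`, the regularization is `√t` times a bounded factor, the scale on which the
score sum fluctuates. -/
theorem mul_reg (uW α : ℝ) {t : ℕ} (ht : 1 ≤ t) (ω : Ω) : t * R.reg uW α t ω =
    √t * (4 * uW * √(2 * (⨆ i, |R.empCov t ω i i|) * Real.log (2 * d / α))) := by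
  have ht0 : (0 : ℝ) < t := by exact_mod_cast ht
  have e : 2 * (t : ℝ)⁻¹ * (⨆ i, |R.empCov t ω i i|) * Real.log (2 * d / α) =
      (t : ℝ)⁻¹ * (2 * (⨆ i, |R.empCov t ω i i|) * Real.log (2 * d / α)) := by ring
  rw [reg, e, Real.sqrt_mul (by positivity), Real.sqrt_inv]
  have hst : √(t : ℝ) * √(t : ℝ) = t := Real.mul_self_sqrt ht0.le
  have hst0 : 0 < √(t : ℝ) := Real.sqrt_pos.2 ht0
  nth_rewrite 1 [← hst]
  field_simp

/-! ### Strong convexity of the likelihood and the basic inequality -/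

namespace IsOORMLP

variable {R θ₀} [m0 : MeasurableSpace Ω] {μ : Measure Ω} {T : ℕ}
  {W uW lW α : ℝ} (h : R.IsOORMLP θ₀ μ T W uW lW α)
include h

/-- Passing from `θ₀` to `θ` moves the cutoff by `-⟨θ - θ₀, x⟩`, and the score is the slope at `θ₀`.
The null set is chosen before `θ`, so that the random estimator may be inserted. -/
theorem ae_log_saleProb_ge (hθ : l1 θ₀ ≤ W) {s : ℕ} (hs : s ∈ Finset.Icc 1 T) :
    ∀ᵐ ω ∂μ, ∀ θ : Fin d → ℝ, l1 θ ≤ W →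
      Real.log (1 / R.saleProb θ₀ θ₀ s ω) - R.score θ₀ s ω * (θ - θ₀) ⬝ᵥ R.x s ω +
        lW / 2 * ((θ - θ₀) ⬝ᵥ R.x s ω) ^ 2 ≤ Real.log (1 / R.saleProb θ₀ θ s ω) := by
  filter_upwards [h.ae_score_eq hθ hs, h.isNoiseLaw s hs, h.ae_sub_mem hs] with ω he hN hz θ hθ'
  have h0 := hz θ₀ hθ
  have h1 := hz θ hθ'
  have e : R.p s ω - θ ⬝ᵥ R.x s ω - (R.p s ω - θ₀ ⬝ᵥ R.x s ω) = -((θ - θ₀) ⬝ᵥ R.x s ω) := by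
    rw [sub_dotProduct]; ring
  rw [he]
  simp only [saleProb, one_div, Real.log_inv]
  split_ifs
  · have := hN.neg_log_tail_ge h0 h1
    rw [e] at this
    rw [cutoff]
    linarith
  · have := hN.neg_log_cdf_ge h0 h1
    rw [e] at this
    rw [cutoff]
    linarith

/-- Basic inequality of the lasso. -/
theorem ae_basic_inequality (hθ : l1 θ₀ ≤ W) {t : ℕ} (ht : t ∈ Finset.Ico 1 T)
    {J : Finset (Fin d)} (hJ : ∀ i ∉ J, θ₀ i = 0) (hreg : ∀ ω, 0 ≤ R.reg uW α t ω) :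
    ∀ᵐ ω ∂μ, lW / 2 * gram (fun s => R.x s ω) t (R.est t ω - θ₀) + t * R.reg uW α t ω *
      (∑ i ∈ Jᶜ, |(R.est t ω - θ₀) i| - ∑ i ∈ J, |(R.est t ω - θ₀) i|) ≤
        (R.est t ω - θ₀) ⬝ᵥ R.scoreSum θ₀ t ω := by
  obtain ⟨h1t, htT⟩ := Finset.mem_Ico.1 ht
  have ht0 : (0 : ℝ) < t := by exact_mod_cast h1t
  have hall : ∀ᵐ ω ∂μ, ∀ s ∈ Finset.Icc 1 t, ∀ θ : Fin d → ℝ, l1 θ ≤ W →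
      Real.log (1 / R.saleProb θ₀ θ₀ s ω) - R.score θ₀ s ω * (θ - θ₀) ⬝ᵥ R.x s ω +
        lW / 2 * ((θ - θ₀) ⬝ᵥ R.x s ω) ^ 2 ≤ Real.log (1 / R.saleProb θ₀ θ s ω) :=
    (Filter.eventually_all_finset _).2 fun s hs =>
      h.ae_log_saleProb_ge hθ (Finset.Icc_subset_Icc_right htT.le hs)
  filter_upwards [hall, h.isLasso_est t ht] with ω hs hL
  have h2 : R.loss θ₀ t ω (R.est t ω) + R.reg uW α t ω * l1 (R.est t ω) ≤
      R.loss θ₀ t ω θ₀ + R.reg uW α t ω * l1 θ₀ := hL.2 hθ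
  have h3 := Finset.sum_le_sum fun s hs' => hs s hs' (R.est t ω) hL.1
  rw [Finset.sum_add_distrib, Finset.sum_sub_distrib, ← dotProduct_scoreSum,
    ← Finset.mul_sum] at h3
  have h4 : ∀ θ, t * R.loss θ₀ t ω θ =
      ∑ s ∈ Finset.Icc 1 t, Real.log (1 / R.saleProb θ₀ θ s ω) := fun θ => by
    rw [loss, mul_inv_cancel_left₀ ht0.ne']
  rw [← h4, ← h4] at h3
  -- Off `J` the error is the estimator itself; on `J` the triangle inequality applies.
  have h5 : ∑ i ∈ Jᶜ, |(R.est t ω - θ₀) i| - ∑ i ∈ J, |(R.est t ω - θ₀) i| ≤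
      l1 (R.est t ω) - l1 θ₀ := by
    rw [l1_split J, l1_split J θ₀]
    have e1 : ∑ i ∈ Jᶜ, |(R.est t ω - θ₀) i| = ∑ i ∈ Jᶜ, |R.est t ω i| :=
      Finset.sum_congr rfl fun i hi => by
        rw [Pi.sub_apply, hJ i (Finset.mem_compl.1 hi), sub_zero]
    have e2 : ∑ i ∈ Jᶜ, |θ₀ i| = 0 := Finset.sum_eq_zero fun i hi => by
      rw [hJ i (Finset.mem_compl.1 hi), abs_zero]
    have e3 : ∑ i ∈ J, |θ₀ i| ≤ ∑ i ∈ J, |R.est t ω i| + ∑ i ∈ J, |(R.est t ω - θ₀) i| := by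
      rw [← Finset.sum_add_distrib]
      refine Finset.sum_le_sum fun i _ => ?_
      rw [Pi.sub_apply, abs_sub_comm]
      linarith [abs_sub_abs_le_abs_sub (θ₀ i) (R.est t ω i)]
    linarith
  have h6 := mul_le_mul_of_nonneg_left h2 ht0.le
  have h7 := mul_le_mul_of_nonneg_left h5 (mul_nonneg ht0.le (hreg ω))
  have h8 : lW / 2 * gram (fun s => R.x s ω) t (R.est t ω - θ₀) = lW / 2 *
    ∑ s ∈ Finset.Icc 1 t, ((R.est t ω - θ₀) ⬝ᵥ R.x s ω) ^ 2 := rfl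
  linarith

end IsOORMLP
end Run

/-! ### The mean squared estimation error -/

/-- The mean squared error of the estimator is of order `1 / t`. -/
theorem exists_integral_sqError_le (d : ℕ) {W uW lW α φmin : ℝ} (hu : 0 < uW)
    (hl : 0 < lW) (hα : 0 < α) (hα1 : α < 1) (hφm : 0 < φmin) :
    ∃ K : ℝ, 0 < K ∧ ∀ {Ω : Type*} [MeasurableSpace Ω] (μ : Measure Ω) [IsProbabilityMeasure μ]
      (R : Run d Ω) (θ₀ : Fin d → ℝ) (s₀ n₀ T : ℕ) (φ : ℕ → ℝ), 1 ≤ s₀ →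
      θ₀ ∈ paramSpace d s₀ W → R.IsOORMLP θ₀ μ T W uW lW α → R.SatisfiesRE μ s₀ n₀ T φ →
      (∀ t ∈ Finset.Icc 1 T, n₀ ≤ t → φmin ≤ φ t) → ∀ t ∈ Finset.Ico 1 T, n₀ ≤ t →
      ∫ ω, sqL2 (R.est t ω - θ₀) ∂μ ≤ K / t := by
  -- For `d = 0` the error vanishes, while `log (2 d / α)` takes the default value `0` and could not
  -- bound the regularization from below.
  rcases Nat.eq_zero_or_pos d with rfl | hd
  · refine ⟨1, one_pos, fun {Ω} _ μ _ R θ₀ s₀ n₀ T φ _ _ _ _ _ t _ _ => ?_⟩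
    simp only [sqL2, Finset.univ_eq_empty, Finset.sum_empty, integral_zero]
    positivity
  have hd0 : (0 : ℝ) < d := by exact_mod_cast hd
  have hL : 0 < Real.log (2 * d / α) := by
    refine Real.log_pos ?_
    rw [one_lt_div hα]
    have : (1 : ℝ) ≤ d := by exact_mod_cast hd
    linarith
  set L := Real.log (2 * d / α)
  -- `Λ₀` and `Λ₁` enclose `√t` times the regularization, since the largest diagonal entry lies
  -- between `φmin ^ 2` and `1`.
  set Λ₀ := 4 * uW * √(2 * φmin ^ 2 * L) with hΛ₀
  set Λ₁ := 4 * uW * √(2 * 1 * L) with hΛ₁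
  have hΛ₀p : 0 < Λ₀ := by positivity
  set β := lW / (2 * uW ^ 2) with hβ
  set c := β * Λ₀ / 4 with hc
  have hβp : 0 < β := by positivity
  have hcp : 0 < c := by positivity
  set D := 16 * (2 * d / (lW * φmin ^ 2)) ^ 2 with hD
  set A := D * (2 * Λ₁ ^ 2) + 32 / Λ₀ ^ 2 * (lW ^ 2 * d ^ 4 / 4) with hA
  set B := D * 32 + 32 / Λ₀ ^ 2 * d ^ 2 with hB
  set E := 8 / c ^ 2 * Real.exp (c * d / 2) with hE
  set G := (∑' k : ℤ, Real.exp (-(c / 2) * |(k : ℝ)|)) ^ d with hG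
  have hDp : 0 < D := by positivity
  have hAp : 0 < A := by positivity
  have hBp : 0 < B := by positivity
  have hEp : 0 < E := by positivity
  have hGp : 0 ≤ G := pow_nonneg (tsum_nonneg fun _ => (Real.exp_pos _).le) _
  refine ⟨A + B * (d * (2 * Real.exp (uW ^ 2 / 2) * (1 + 1))) + E * G, by positivity, ?_⟩
  intro Ω _ μ _ R θ₀ s₀ n₀ T φ hs₀ hθ h hRE hφ t ht hnt
  obtain ⟨h1t, htT⟩ := Finset.mem_Ico.1 ht
  have ht0 : (0 : ℝ) < t := by exact_mod_cast h1t
  have htI : t ∈ Finset.Icc 1 T := Finset.mem_Icc.2 ⟨h1t, htT.le⟩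
  let J : Finset (Fin d) := Finset.univ.filter fun i => θ₀ i ≠ 0
  have hJ : ∀ i ∉ J, θ₀ i = 0 := fun i hi => by simpa [J] using hi
  have hJc : J.card ≤ s₀ := by
    refine le_trans (le_of_eq ?_) hθ.1
    rw [← Set.ncard_coe_finset]
    congr 1
    ext i; simp [J]
  have hreg : ∀ ω, 0 ≤ R.reg uW α t ω := fun ω =>
    mul_nonneg (by positivity) (Real.sqrt_nonneg _)
  have hx : ∀ᵐ ω ∂μ, ∀ s ∈ Finset.Icc 1 t, ∀ i, |R.x s ω i| ≤ 1 :=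
    (Filter.eventually_all_finset _).2 fun s hs =>
      h.abs_x_le s (Finset.Icc_subset_Icc_right htT.le hs)
  set n : ℕ := ⌈2 * W * √(t : ℝ) + 1⌉₊ with hn
  let box : Finset (Fin d → ℤ) := Fintype.piFinset fun _ => Finset.Icc (-(n : ℤ)) n
  let w : (Fin d → ℤ) → Fin d → ℝ := fun k => (β / √(t : ℝ)) • fun i => (k i : ℝ)
  let N : Ω → ℝ := fun ω => ∑ i, 2 * Real.exp (uW ^ 2 / 2) *
    (R.expScore θ₀ uW (Pi.single i (1 / √(t : ℝ))) t ω +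
      R.expScore θ₀ uW (Pi.single i (-(1 / √(t : ℝ)))) t ω)
  let Z : Ω → ℝ := fun ω => ∑ k ∈ box, Real.exp (-(c / 2) * l1 fun i => (k i : ℝ)) *
    R.expScore θ₀ uW (w k) t ω
  have hpoint : ∀ᵐ ω ∂μ, t * sqL2 (R.est t ω - θ₀) ≤ A + B * N ω + E * Z ω := by
    filter_upwards [h.ae_basic_inequality hθ.2 ht hJ hreg, hx, h.ae_l1_error_le hθ.2 ht, hRE]
      with ω hbasic hx hv hRE
    have hREt : RestrictedEigenvalueGE s₀ (R.empCov t ω) (φmin ^ 2) := fun J hJ v hv hcone =>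
      (pow_le_pow_left₀ hφm.le (hφ t htI hnt) 2).trans (hRE t htI hnt J hJ v hv hcone)
    rw [R.mul_reg uW α h1t ω] at hbasic
    set v := R.est t ω - θ₀
    set S := R.scoreSum θ₀ t ω
    have hN : ∑ j, S j ^ 2 / (t : ℝ) ≤ N ω :=
      Finset.sum_le_sum fun i _ => sq_div_le_exp (u := uW) h1t hx S i
    have hN0 : 0 ≤ ∑ j, S j ^ 2 / (t : ℝ) := Finset.sum_nonneg fun j _ => by positivity
    have hZ0 : 0 ≤ Z ω := Finset.sum_nonneg fun k _ =>
      mul_nonneg (Real.exp_pos _).le (R.expScore_pos θ₀ uW _ t ω).le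
    have hσ1 := R.iSup_empCov_le h1t hx
    have hσ0 := R.le_iSup_empCov hs₀ ⟨0, hd⟩ hREt
    set σ := ⨆ i, |R.empCov t ω i i|
    have hΛ1 : 4 * uW * √(2 * σ * L) ≤ Λ₁ := by
      rw [hΛ₁]; gcongr
    have hΛ0 : Λ₀ ≤ 4 * uW * √(2 * σ * L) := by
      rw [hΛ₀]; gcongr
    have hfirst : t * sqL2 v ≤ t * l1 v ^ 2 :=
      mul_le_mul_of_nonneg_left (sqL2_le_l1_sq v) ht0.le
    refine hfirst.trans ?_
    have hEZ : 0 ≤ E * Z ω := mul_nonneg hEp.le hZ0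
    have hDN : D * ∑ j, S j ^ 2 / (t : ℝ) ≤ D * N ω := mul_le_mul_of_nonneg_left hN hDp.le
    have hd2N : 32 / Λ₀ ^ 2 * d ^ 2 * ∑ j, S j ^ 2 / (t : ℝ) ≤ 32 / Λ₀ ^ 2 * d ^ 2 * N ω :=
      mul_le_mul_of_nonneg_left hN (by positivity)
    have p1 : 0 ≤ D * (2 * Λ₁ ^ 2) := by positivity
    have p2 : 0 ≤ 32 / Λ₀ ^ 2 * (lW ^ 2 * d ^ 4 / 4) := by positivity
    have p3 : 0 ≤ D * N ω := mul_nonneg hDp.le (hN0.trans hN)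
    have p4 : 0 ≤ 32 / Λ₀ ^ 2 * d ^ 2 * N ω := mul_nonneg (by positivity) (hN0.trans hN)
    rcases le_or_gt (∑ i ∈ Jᶜ, |v i|) (3 * ∑ i ∈ J, |v i|) with hcone | hcone
    · have := sq_le_of_mem_cone hl hφm hΛ1 (hΛ₀p.le.trans hΛ0) ht0 hd hcone
        (R.mul_sum_sq_le_gram h1t hREt hJc hcone) hbasic
      rw [← hD] at this
      rw [hA, hB]
      linarith
    -- Outside the cone the part of the error off `J` exceeds three times the part on `J`, so their
    -- difference is at least half of the whole `ℓ₁` norm.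
    · have hb : lW / 2 * gram (fun s => R.x s ω) t v + √(t : ℝ) * Λ₀ * l1 v / 2 ≤ v ⬝ᵥ S := by
        refine le_trans ?_ hbasic
        rw [l1_split J v]
        have q1 : 0 ≤ ∑ i ∈ J, |v i| := Finset.sum_nonneg fun _ _ => abs_nonneg _
        have q2 : √(t : ℝ) * Λ₀ * ((∑ i ∈ J, |v i| + ∑ i ∈ Jᶜ, |v i|) / 2) ≤
            √(t : ℝ) * (4 * uW * √(2 * σ * L)) * (∑ i ∈ Jᶜ, |v i| - ∑ i ∈ J, |v i|) := by
          refine mul_le_mul (mul_le_mul_of_nonneg_left hΛ0 (Real.sqrt_nonneg _)) (by linarith)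
            (by linarith) (by positivity)
        linarith
      rcases sq_le_of_notMem_cone hl hu hΛ₀p hβ hc h1t hx hv (Nat.le_ceil _) hb with h1 | h1
      · rw [hA, hB]
        linarith
      · have hZ : t * l1 v ^ 2 ≤ E * Z ω := h1
        rw [hA, hB]
        linarith
  have hiNi : ∀ i ∈ (Finset.univ : Finset (Fin d)), Integrable (fun ω => 2 *
      Real.exp (uW ^ 2 / 2) * (R.expScore θ₀ uW (Pi.single i (1 / √(t : ℝ))) t ω +
      R.expScore θ₀ uW (Pi.single i (-(1 / √(t : ℝ)))) t ω)) μ := fun i _ =>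
    ((h.integrable_expScore hθ.2 _ htT.le).add
      (h.integrable_expScore hθ.2 _ htT.le)).const_mul _
  have hiN : Integrable N μ := integrable_finsetSum _ hiNi
  have hiZ : Integrable Z μ := integrable_finsetSum _ fun k _ =>
    (h.integrable_expScore hθ.2 _ htT.le).const_mul _
  have hIN : ∫ ω, N ω ∂μ ≤ d * (2 * Real.exp (uW ^ 2 / 2) * (1 + 1)) := by
    rw [integral_finsetSum _ hiNi]
    have : ∀ i ∈ (Finset.univ : Finset (Fin d)), ∫ ω, 2 * Real.exp (uW ^ 2 / 2) *
        (R.expScore θ₀ uW (Pi.single i (1 / √(t : ℝ))) t ω +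
        R.expScore θ₀ uW (Pi.single i (-(1 / √(t : ℝ)))) t ω) ∂μ ≤
        2 * Real.exp (uW ^ 2 / 2) * (1 + 1) := fun i _ => by
      rw [integral_const_mul, integral_add (h.integrable_expScore hθ.2 _ htT.le)
        (h.integrable_expScore hθ.2 _ htT.le)]
      exact mul_le_mul_of_nonneg_left (add_le_add (h.integral_expScore_le hu hθ.2 _ htT.le)
        (h.integral_expScore_le hu hθ.2 _ htT.le)) (by positivity)
    refine (Finset.sum_le_sum this).trans (le_of_eq ?_)
    simp
  have hIZ : ∫ ω, Z ω ∂μ ≤ G := by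
    rw [integral_finsetSum _ fun k _ => (h.integrable_expScore hθ.2 _ htT.le).const_mul _]
    refine le_trans (Finset.sum_le_sum fun k _ => ?_) (sum_box_exp_le (half_pos hcp) n)
    rw [integral_const_mul]
    exact mul_le_of_le_one_right (Real.exp_pos _).le (h.integral_expScore_le hu hθ.2 _ htT.le)
  have hiA : Integrable (fun ω => A + B * N ω) μ := (integrable_const A).add (hiN.const_mul B)
  rw [le_div_iff₀ ht0, mul_comm, ← integral_const_mul]
  calc ∫ ω, t * sqL2 (R.est t ω - θ₀) ∂μ ≤ ∫ ω, (A + B * N ω + E * Z ω) ∂μ :=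
        integral_mono_ae ((h.integrable_sqError hθ.2 ht).const_mul _)
          (hiA.add (hiZ.const_mul E)) hpoint
    _ = A + B * ∫ ω, N ω ∂μ + E * ∫ ω, Z ω ∂μ := by
        rw [integral_add hiA (hiZ.const_mul E),
          integral_add (integrable_const A) (hiN.const_mul B), integral_const_mul,
          integral_const_mul, integral_const]
        simp
    _ ≤ _ := add_le_add (add_le_add le_rfl (mul_le_mul_of_nonneg_left hIN hBp.le))
        (mul_le_mul_of_nonneg_left hIZ hEp.le)

/-- The mean squared error of the estimator is of order `1 / t`, including the rounds before the
restricted eigenvalue condition holds. -/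
theorem exists_integral_sqError_le_div (d n₀ : ℕ) {W uW lW α φmin : ℝ} (hW : 0 < W)
    (hl : 0 < lW) (hα : 0 < α) (hα1 : α < 1) (hφm : 0 < φmin) :
    ∃ D : ℝ, 0 < D ∧ ∀ {Ω : Type*} [MeasurableSpace Ω] (μ : Measure Ω) [IsProbabilityMeasure μ]
      (R : Run d Ω) (θ₀ : Fin d → ℝ) (s₀ T : ℕ) (φ : ℕ → ℝ), 1 ≤ s₀ →
      θ₀ ∈ paramSpace d s₀ W → R.IsOORMLP θ₀ μ T W uW lW α → R.SatisfiesRE μ s₀ n₀ T φ →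
      (∀ t ∈ Finset.Icc 1 T, n₀ ≤ t → φmin ≤ φ t) → ∀ t ∈ Finset.Ico 1 T,
      ∫ ω, sqL2 (R.est t ω - θ₀) ∂μ ≤ D / t := by
  -- If `uW ≤ 0` there is no noise law, so the claim is vacuous as soon as there is a round.
  by_cases hu : 0 < uW
  swap
  · refine ⟨1, one_pos, fun {Ω} _ μ _ R θ₀ s₀ T φ _ _ h _ _ t ht => (hu ?_).elim⟩
    obtain ⟨ω, hω⟩ := (h.isNoiseLaw t (Finset.Ico_subset_Icc_self ht)).exists
    exact hω.steepness_pos hW hl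
  obtain ⟨K, hK, hrate⟩ := exists_integral_sqError_le d (W := W) hu hl hα hα1 hφm
  refine ⟨K + (2 * W) ^ 2 * n₀, by positivity, ?_⟩
  intro Ω _ μ _ R θ₀ s₀ T φ hs₀ hθ h hRE hφ t ht
  have ht0 : (0 : ℝ) < t := by exact_mod_cast (Finset.mem_Ico.1 ht).1
  rcases le_or_gt n₀ t with hn | hn
  · refine (hrate μ R θ₀ s₀ n₀ T φ hs₀ hθ h hRE hφ t ht hn).trans ?_
    gcongr
    have : 0 ≤ (2 * W) ^ 2 * (n₀ : ℝ) := by positivity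
    linarith
  -- For `t < n₀` the diameter bound `(2W)²` is at most `(2W)² n₀ / t`.
  · have h1 : ∫ ω, sqL2 (R.est t ω - θ₀) ∂μ ≤ (2 * W) ^ 2 := by
      have := integral_mono_ae (h.integrable_sqError hθ.2 ht) (integrable_const ((2 * W) ^ 2))
        ((h.ae_l1_error_le hθ.2 ht).mono fun ω hω =>
          (sqL2_le_l1_sq _).trans (pow_le_pow_left₀ (l1_nonneg _) hω 2))
      simpa using this
    refine h1.trans ?_
    rw [le_div_iff₀ ht0]
    have : (t : ℝ) ≤ n₀ := by exact_mod_cast hn.le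
    have := mul_le_mul_of_nonneg_left this (sq_nonneg (2 * W))
    linarith

/-! ### From squared errors to regret -/

/-- The harmonic sum is at most `1 + log T`, and for `T ≥ 2` the `1` is absorbed by `log T / log 2`.
-/
theorem sum_one_div_pred_le {T : ℕ} (hT : 2 ≤ T) :
    ∑ t ∈ Finset.Icc 2 T, 1 / ((t - 1 : ℕ) : ℝ) ≤ (1 / Real.log 2 + 1) * Real.log T := by
  have h1 : ∑ t ∈ Finset.Icc 2 T, 1 / ((t - 1 : ℕ) : ℝ) =
      ∑ s ∈ Finset.Icc 1 (T - 1), 1 / (s : ℝ) := by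
    refine Finset.sum_nbij' (fun t => t - 1) (fun s => s + 1) ?_ ?_ ?_ ?_ ?_
    · intro t ht; simp only [Finset.mem_Icc] at ht ⊢; omega
    · intro t ht; simp only [Finset.mem_Icc] at ht ⊢; omega
    · intro t ht; simp only [Finset.mem_Icc] at ht; omega
    · intro t ht; omega
    · intro t ht; rfl
  have h2 := harmonic_le_one_add_log (T - 1)
  rw [harmonic_eq_sum_Icc] at h2
  push_cast at h2
  rw [h1]
  simp only [one_div]
  have hl2 : 0 < Real.log 2 := Real.log_pos one_lt_two
  have h3 : Real.log ((T - 1 : ℕ) : ℝ) ≤ Real.log T := by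
    refine Real.log_le_log (by exact_mod_cast (by omega : 0 < T - 1)) ?_
    exact_mod_cast Nat.sub_le T 1
  have h4 : 1 ≤ (Real.log 2)⁻¹ * Real.log T := by
    rw [← div_eq_inv_mul, one_le_div hl2]
    exact Real.log_le_log two_pos (by exact_mod_cast hT)
  linarith

/-- All bounds for one run in terms of the rate of the mean squared errors. -/
theorem Run.IsOORMLP.regret_bounds {d : ℕ} {Ω : Type*} [MeasurableSpace Ω] {μ : Measure Ω}
    [IsProbabilityMeasure μ] {R : Run d Ω} {θ₀ : Fin d → ℝ} {T : ℕ} {W uW lW α D C₁ : ℝ}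
    (h : R.IsOORMLP θ₀ μ T W uW lW α) (hW : 0 < W) (hl : 0 < lW) (hα : 0 < α) (hα1 : α < 1)
    (hD : 0 < D) (hC₁ : 0 < C₁) (hC : (2 * uW + 2 * W * uW ^ 2) * d ≤ C₁) (hT : 2 ≤ T)
    (hθ : l1 θ₀ ≤ W)
    (hrate : ∀ t ∈ Finset.Ico 1 T, ∫ ω, sqL2 (R.est t ω - θ₀) ∂μ ≤ D / t) :
    R.expectedRegret θ₀ μ T ≤
      (4 * W / Real.log 2 + C₁ * (D * (1 / Real.log 2 + 1) / α)) * Real.log T ∧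
    R.expectedRegret θ₀ μ T ≤ (∫ ω, R.revenueLoss θ₀ 1 ω ∂μ) +
      C₁ * ∑ t ∈ Finset.Icc 2 T, ∫ ω, sqL2 (R.est (t - 1) ω - θ₀) ∂μ ∧
    1 - α ≤ μ.real {ω |
      ∑ t ∈ Finset.Icc 1 T, R.condLoss θ₀ μ t ω ≤
        R.condLoss θ₀ μ 1 ω + C₁ * ∑ t ∈ Finset.Icc 2 T, R.condSqError θ₀ μ t ω ∧
      R.condLoss θ₀ μ 1 ω + C₁ * ∑ t ∈ Finset.Icc 2 T, R.condSqError θ₀ μ t ω ≤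
        (4 * W / Real.log 2 + C₁ * (D * (1 / Real.log 2 + 1) / α)) * Real.log T} := by
  have h1T : 1 ∈ Finset.Icc 1 T := Finset.mem_Icc.2 ⟨le_rfl, by omega⟩
  have hsub : ∀ t ∈ Finset.Icc 2 T, t ∈ Finset.Icc 1 T ∧ t - 1 ∈ Finset.Ico 1 T := by
    intro t ht
    simp only [Finset.mem_Icc, Finset.mem_Ico] at ht ⊢
    omega
  have hsplit : ∀ f : ℕ → ℝ, ∑ t ∈ Finset.Icc 1 T, f t = f 1 + ∑ t ∈ Finset.Icc 2 T, f t := by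
    intro f
    have : Finset.Icc 1 T = insert 1 (Finset.Icc 2 T) := by
      ext t
      simp only [Finset.mem_Icc, Finset.mem_insert]
      omega
    rw [this, Finset.sum_insert (by simp)]
  have hint : ∀ t ∈ Finset.Icc 1 T, Integrable (R.revenueLoss θ₀ t) μ := fun t ht =>
    (h.revenueLoss_spec hW hl hθ ht).1
  have hsq : ∀ t ∈ Finset.Icc 2 T, Integrable (fun ω => sqL2 (R.est (t - 1) ω - θ₀)) μ :=
    fun t ht => h.integrable_sqError hθ (hsub t ht).2
  have hloss : ∀ t ∈ Finset.Icc 2 T, ∀ᵐ ω ∂μ,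
      R.condLoss θ₀ μ t ω ≤ C₁ * sqL2 (R.est (t - 1) ω - θ₀) := fun t ht =>
    (h.condLoss_le hW hl hθ ht).mono fun ω hω =>
      hω.trans (mul_le_mul_of_nonneg_right hC (sqL2_nonneg _))
  have hl2 : 0 < Real.log 2 := Real.log_pos one_lt_two
  have hlT : Real.log 2 ≤ Real.log T := Real.log_le_log two_pos (by exact_mod_cast hT)
  have hlT0 : 0 < Real.log T := hl2.trans_le hlT
  have h4W : 4 * W ≤ 4 * W / Real.log 2 * Real.log T := by
    rw [div_mul_eq_mul_div, le_div_iff₀ hl2]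
    exact mul_le_mul_of_nonneg_left hlT (by positivity)
  set H := D * (1 / Real.log 2 + 1) with hH
  have hHp : 0 < H := by positivity
  have hsum : ∑ t ∈ Finset.Icc 2 T, ∫ ω, sqL2 (R.est (t - 1) ω - θ₀) ∂μ ≤ H * Real.log T := by
    have h1 : ∀ t ∈ Finset.Icc 2 T, ∫ ω, sqL2 (R.est (t - 1) ω - θ₀) ∂μ ≤
        D * (1 / ((t - 1 : ℕ) : ℝ)) := fun t ht => by
      rw [mul_one_div]
      exact hrate _ (hsub t ht).2
    refine (Finset.sum_le_sum h1).trans ?_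
    rw [← Finset.mul_sum, hH, mul_assoc]
    exact mul_le_mul_of_nonneg_left (sum_one_div_pred_le hT) hD.le
  have hexp : R.expectedRegret θ₀ μ T ≤ (∫ ω, R.revenueLoss θ₀ 1 ω ∂μ) +
      C₁ * ∑ t ∈ Finset.Icc 2 T, ∫ ω, sqL2 (R.est (t - 1) ω - θ₀) ∂μ := by
    rw [Run.expectedRegret, integral_finsetSum _ hint, hsplit, Finset.mul_sum]
    refine add_le_add le_rfl (Finset.sum_le_sum fun t ht => ?_)
    rw [← integral_condExp (h.hist_le (hsub t ht).1), ← integral_const_mul]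
    exact integral_mono_ae integrable_condExp ((hsq t ht).const_mul C₁) (hloss t ht)
  have hfirst : ∫ ω, R.revenueLoss θ₀ 1 ω ∂μ ≤ 4 * W := by
    have := integral_mono_ae (hint 1 h1T) (integrable_const (4 * W))
      ((h.ae_abs_revenueLoss_le hθ h1T).mono fun ω hω => (le_abs_self _).trans hω)
    simpa using this
  refine ⟨?_, hexp, ?_⟩
  · refine hexp.trans ?_
    rw [add_mul]
    refine add_le_add (hfirst.trans h4W) ?_
    rw [mul_assoc]
    refine mul_le_mul_of_nonneg_left (hsum.trans ?_) hC₁.le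
    -- Only the bound in probability needs the factor `1 / α`; as `α < 1`, the same constant serves
    -- the expectation.
    refine mul_le_mul_of_nonneg_right ?_ hlT0.le
    rw [le_div_iff₀ hα]
    exact mul_le_of_le_one_right hHp.le hα1.le
  · let X : Ω → ℝ := fun ω => ∑ t ∈ Finset.Icc 2 T, sqL2 (R.est (t - 1) ω - θ₀)
    have hX0 : ∀ ω, 0 ≤ X ω := fun ω => Finset.sum_nonneg fun t _ => sqL2_nonneg _
    have hXi : Integrable X μ := integrable_finsetSum _ hsq
    have hXe : ∫ ω, X ω ∂μ ≤ H * Real.log T := by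
      rw [integral_finsetSum _ hsq]
      exact hsum
    -- The level at which Markov's inequality leaves probability at most `α`.
    set a := H / α * Real.log T with ha
    have hap : 0 < a := by positivity
    have hmarkov : μ.real {ω | a ≤ X ω} ≤ α := by
      have h1 := mul_meas_ge_le_integral_of_nonneg (Eventually.of_forall hX0) hXi a
      have h2 : a * μ.real {ω | a ≤ X ω} ≤ a * α := by
        refine h1.trans (hXe.trans (le_of_eq ?_))
        rw [ha]; field_simp
      exact le_of_mul_le_mul_left h2 hap
    have hcompl : 1 - α ≤ μ.real {ω | a ≤ X ω}ᶜ := by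
      rw [probReal_compl_eq_one_sub₀ (nullMeasurableSet_le aemeasurable_const hXi.aemeasurable)]
      linarith
    refine hcompl.trans (ENNReal.toReal_mono (measure_ne_top _ _) (measure_mono_ae ?_))
    have hcond1 : R.condLoss θ₀ μ 1 ≤ᵐ[μ] fun _ => 4 * W := by
      have := condExp_mono (m := R.hist θ₀ 1) (hint 1 h1T) (integrable_const (4 * W))
        ((h.ae_abs_revenueLoss_le hθ h1T).mono fun ω hω => (le_abs_self _).trans hω)
      rwa [condExp_const (h.hist_le h1T)] at this
    filter_upwards [hcond1, (Filter.eventually_all_finset _).2 hloss] with ω h1 h2 hω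
    have h3 : X ω < a := not_le.1 hω
    have h4 : ∑ t ∈ Finset.Icc 2 T, R.condSqError θ₀ μ t ω = X ω :=
      Finset.sum_congr rfl fun t ht => by rw [h.condSqError_eq hθ ht]
    refine ⟨?_, ?_⟩
    · rw [hsplit, h4, Finset.mul_sum]
      exact add_le_add le_rfl (Finset.sum_le_sum h2)
    · rw [h4, add_mul, mul_assoc, ← ha]
      exact add_le_add (h1.trans h4W) (mul_le_mul_of_nonneg_left h3.le hC₁.le)

end OORMLP

end

theorem theorem2 (d : ℕ) (W uW : ℝ) (hW : 0 < W) :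
    ∃ C₁ : ℝ, 0 < C₁ ∧
      ∀ (s₀ n₀ : ℕ) (lW α φmin : ℝ), 1 ≤ s₀ → 0 < lW → 0 < α → α < 1 → 0 < φmin →
        ∃ C₂ : ℝ, 0 < C₂ ∧
          ∀ (T : ℕ), 2 ≤ T → ∀ (φ : ℕ → ℝ), (∀ t ∈ Finset.Icc 1 T, n₀ ≤ t → φmin ≤ φ t) →
          ∀ (Θ : Set (Fin d → ℝ)), Θ ⊆ OORMLP.paramSpace d s₀ W →
          ∀ (Ω : (Fin d → ℝ) → Type*) [∀ θ, MeasurableSpace (Ω θ)]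
            (μ : ∀ θ, Measure (Ω θ)) [∀ θ, IsProbabilityMeasure (μ θ)]
            (R : ∀ θ, OORMLP.Run d (Ω θ)),
            (∀ θ₀ ∈ Θ, (R θ₀).IsOORMLP θ₀ (μ θ₀) T W uW lW α) →
            (∀ θ₀ ∈ Θ, (R θ₀).SatisfiesRE (μ θ₀) s₀ n₀ T φ) →
            -- the (worst-case, expected) regret is logarithmic
            OORMLP.regret Θ Ω μ R T ≤ ((C₂ * Real.log T : ℝ) : EReal) ∧
            ∀ θ₀ ∈ Θ,
              (∀ t ∈ Finset.Icc 1 T, Integrable ((R θ₀).revenueLoss θ₀ t) (μ θ₀)) ∧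
              (∀ t ∈ Finset.Icc 2 T,
                Integrable (fun ω => OORMLP.sqL2 ((R θ₀).est (t - 1) ω - θ₀)) (μ θ₀)) ∧
              -- expected regret against the expected squared estimation errors
              (R θ₀).expectedRegret θ₀ (μ θ₀) T ≤
                (∫ ω, (R θ₀).revenueLoss θ₀ 1 ω ∂(μ θ₀)) +
                  C₁ * ∑ t ∈ Finset.Icc 2 T,
                    ∫ ω, OORMLP.sqL2 ((R θ₀).est (t - 1) ω - θ₀) ∂(μ θ₀) ∧
              -- the chain of bounds along the conditional expectations, with probability `1 - α`
              1 - α ≤ (μ θ₀).real {ω |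
                ∑ t ∈ Finset.Icc 1 T, (R θ₀).condLoss θ₀ (μ θ₀) t ω ≤
                  (R θ₀).condLoss θ₀ (μ θ₀) 1 ω +
                    C₁ * ∑ t ∈ Finset.Icc 2 T, (R θ₀).condSqError θ₀ (μ θ₀) t ω ∧
                (R θ₀).condLoss θ₀ (μ θ₀) 1 ω +
                    C₁ * ∑ t ∈ Finset.Icc 2 T, (R θ₀).condSqError θ₀ (μ θ₀) t ω ≤
                  C₂ * Real.log T} := by
  -- The sign of `uW` is not known here and `d` may be `0`; the absolute value and the `1` make the
  -- constant positive.
  refine ⟨|2 * uW + 2 * W * uW ^ 2| * d + 1, by positivity, ?_⟩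
  set C₁ : ℝ := |2 * uW + 2 * W * uW ^ 2| * d + 1 with hC₁
  have hC₁p : 0 < C₁ := by positivity
  have hC : (2 * uW + 2 * W * uW ^ 2) * d ≤ C₁ := by
    have := mul_le_mul_of_nonneg_right (le_abs_self (2 * uW + 2 * W * uW ^ 2))
      (Nat.cast_nonneg (α := ℝ) d)
    linarith
  intro s₀ n₀ lW α φmin hs₀ hl hα hα1 hφm
  obtain ⟨D, hD, hrate⟩ := OORMLP.exists_integral_sqError_le_div d (uW := uW) n₀ hW hl hα hα1 hφm
  have hl2 : 0 < Real.log 2 := Real.log_pos one_lt_two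
  refine ⟨4 * W / Real.log 2 + C₁ * (D * (1 / Real.log 2 + 1) / α), by positivity, ?_⟩
  intro T hT φ hφ Θ hΘ Ω _ μ _ R hR hRE
  have key := fun θ₀ (hθ : θ₀ ∈ Θ) => (hR θ₀ hθ).regret_bounds hW hl hα hα1 hD hC₁p hC hT
    (hΘ hθ).2 (hrate (μ θ₀) (R θ₀) θ₀ s₀ T φ hs₀ (hΘ hθ) (hR θ₀ hθ) (hRE θ₀ hθ) hφ)
  refine ⟨iSup₂_le fun θ₀ hθ => EReal.coe_le_coe_iff.2 (key θ₀ hθ).1, fun θ₀ hθ =>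
    ⟨fun t ht => ((hR θ₀ hθ).revenueLoss_spec hW hl (hΘ hθ).2 ht).1, fun t ht => ?_,
      (key θ₀ hθ).2.1, (key θ₀ hθ).2.2⟩⟩
  refine (hR θ₀ hθ).integrable_sqError (hΘ hθ).2 ?_
  simp only [Finset.mem_Icc, Finset.mem_Ico] at ht ⊢
  omega
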